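/- **Conventions.** Complexes are cochain complexes. For an abelian category $\mathcal A$ let $\mathrm D(\mathcal A)$ be its derived category and $\mathrm D^b(\mathcal A)$ the full triangulated subcategory of objects with bounded cohomology; put $\inf M=\inf\{i : \mathrm H^iM\ne 0\}$ and $\sup M=\sup\{i : \mathrm H^iM\neq 0\}$. *Level.* Let $\mathcal T$ be a triangulated category and $\mathcal X$ a class of objects. Let $\langle\mathcal X\rangle$ be the class of all direct summands of finite direct sums of shifts of objects of $\mathcal X$. Put $\langle\mathcal X\rangle_0=0$, $\langle\mathcal X\rangle_1=\langle\mathcal X\rangle$ and, for $n>1$, $\langle\mathcal X\rangle_n=\langle\,\langle\mathcal X\rangle_{n-1}*\langle\mathcal X\rangle\,\rangle$, where $E\in\mathcal Y*\mathcal Z$ if there is an exact triangle $Y\to E\to Z\to \Sigma Y$ with $Y\in\mathcal Y$, $Z\in\mathcal Z$. Then $\mathrm{level}^{\mathcal X}_{\mathcal T}M=\inf\{n\ge 0: M\in\langle\mathcal X\rangle_n\}\in\mathbb N\cup\{\infty\}$. A class $\mathcal X$ of objects of $\mathcal A$ is viewed in $\mathrm D^b(\mathcal A)$ as complexes concentrated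 in degree $0$; for $M\in \mathrm D(\mathcal A)$ not in $\mathrm D^b(\mathcal A)$ we set $\mathrm{level}^{\mathcal X}_{\mathrm D^b(\mathcal A)}M=\infty$. *Dimensions.* For $0\ne M\in\mathrm D(\mathcal A)$ with $\sup M<\infty$, the $\mathcal X$-resolution dimension of $M$ is the infimum in $\mathbb Z\cup\{\pm\infty\}$ of the integers $n$ such that $M$ is isomorphic in $\mathrm D(\mathcal A)$ to a complex $0\to X^{-n}\to\cdots\to X^{\sup M}\to 0$ with all $X^i\in\mathcal X$. An object $G$ of $\mathcal A$ is Gorenstein projective if there is an exact complex $P$ of projective objects, with $\mathrm{Hom}(P,Q)$ exact for all projective $Q$, such that $G\cong\mathrm{Coker}(P^{-1}\to P^0)$. For a ring $R$, let $\mathrm{Mod}\,R$ be the category of left $R$-modules and $\mathrm{mod}\,R$ that of the finitely generated ones; $\mathrm{Proj}\,R$ and $\mathrm{GProj}\,R$ are the classes of projective and of Gorenstein projective objects of $\mathrm{Mod}\,R$, and $\mathrm{pd}_R$ and $\mathrm{Gpd}_R$ are the resolution dimensions with respect to them. For $R$ commutative noetherian, $\mathrm{Gdim}_R$ is the resolution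 dimension in $\mathrm D(\mathrm{mod}\,R)$ with respect to the Gorenstein projective objects of $\mathrm{mod}\,R$, and $\mathrm{tref}(R)\subseteq\mathrm{mod}\,R$ consists of the totally reflexive modules, i.e. the finitely generated $N$ such that $N\to N^{**}$ is bijective and $\mathrm{Ext}^i_R(N,R)=0=\mathrm{Ext}^i_R(N^*,R)$ for all $i>0$, where $N^*=\mathrm{Hom}_R(N,R)$. **Corollary.** 1. Let $R$ be any ring, and $M$ a complex of left $R$-modules that is nonzero in $\mathrm D(\mathrm{Mod}\,R)$. Then $$\mathrm{level}^{\mathrm{Proj}\,R}_{\mathrm D^b(\mathrm{Mod}\,R)}M\ \ge\ \mathrm{pd}_RM+\inf M+1 .$$ (If $M\notin\mathrm D^b(\mathrm{Mod}\,R)$, the left side is $\infty$ and the inequality is understood to hold.) 2. Let $R$ be a commutative ring. Then for every nonzero object $M$ of $\mathrm D^b(\mathrm{Mod}\,R)$, $$\mathrm{level}^{\mathrm{GProj}\,R}_{\mathrm D^b(\mathrm{Mod}\,R)}M\ \ge\ \mathrm{Gpd}_RM+\inf M+1 .$$ 3. Let $R$ be a commutative noetherian ring. Then for every nonzero object $M$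 of $\mathrm D^b(\mathrm{mod}\,R)$, $$\mathrm{level}^{\mathrm{tref}(R)}_{\mathrm D^b(\mathrm{mod}\,R)}M\ \ge\ \mathrm{Gdim}_RM+\inf M+1 .$$ -/

import Mathlib

universe w v u

namespace LevelBound

open CategoryTheory CategoryTheory.Limits

section AdditiveCategory

variable {C : Type u} [Category.{v} C] [Preadditive C] [HasFiniteBiproducts C]
  [HasBinaryBiproducts C]

/-- The additive closure of `P`: all direct summands of finite (possibly empty) direct sums of
objects of `P`. -/
def addClosure (P : ObjectProperty C) : ObjectProperty C := fun M =>
  ∃ (k : ℕ) (F : Fin k → C) (N : C), (∀ i, P (F i)) ∧ Nonempty (M ⊞ N ≅ ⨁ F)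

end AdditiveCategory

section Triangulated

variable {T : Type u} [Category.{v} T] [HasZeroObject T] [HasShift T ℤ] [Preadditive T]
  [∀ n : ℤ, (shiftFunctor T n).Additive] [Pretriangulated T]

/-- `⟨P⟩`: the additive closure of the class of all shifts of objects of `P`. -/
def span (P : ObjectProperty T) : ObjectProperty T := addClosure (P.shiftClosure ℤ)

/-- The iterated thickenings `⟨P⟩ₙ`: `⟨P⟩₀ = 0`, `⟨P⟩₁ = ⟨P⟩` and
`⟨P⟩ₙ = ⟨ ⟨P⟩ₙ₋₁ * ⟨P⟩ ⟩` for `n > 1`. Here `E` lies in `X * Y` (written `extensionProduct X Y`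
in Mathlib) if there is an exact triangle `A ⟶ E ⟶ B ⟶ A⟦1⟧` with `A` in `X` and `B` in `Y`. -/
def thickening (P : ObjectProperty T) : ℕ → ObjectProperty T
  | 0 => fun M => IsZero M
  | 1 => span P
  | n + 2 => span (ObjectProperty.extensionProduct (thickening P (n + 1)) (span P))

/-- The level of `M` with respect to `P`: the infimum of all `n ≥ 0` with `M ∈ ⟨P⟩ₙ`; it is `⊤`
if there is no such `n`. -/
noncomputable def level (P : ObjectProperty T) (M : T) : EReal :=
  ⨅ (n : ℕ) (_ : thickening P n M), (n : EReal)

end Triangulated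

section AbelianCategory

variable {A : Type u} [Category.{v} A] [Abelian A]

/-- An object `M` of an abelian category is Gorenstein projective if it has a complete resolution:
an exact complex `P` of projective objects such that `Hom(P, Q)` is exact for every projective
object `Q`, and such that `M` is isomorphic to the cokernel of `P⁻¹ ⟶ P⁰`. -/
def Gproj (A : Type u) [Category.{v} A] [Abelian A] : ObjectProperty A := fun M =>
  ∃ P : CochainComplex A ℤ,
    (∀ n : ℤ, Projective (P.X n)) ∧
    P.Acyclic ∧
    (∀ Q : A, Projective Q → ∀ (n : ℤ) (f : P.X n ⟶ Q), P.d (n - 1) n ≫ f = 0 →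
      ∃ g : P.X (n + 1) ⟶ Q, P.d n (n + 1) ≫ g = f) ∧
    Nonempty (M ≅ P.opcycles 0)

variable [HasDerivedCategory.{w} A]

/-- The supremum of the degrees in which the cohomology of `M` does not vanish. -/
noncomputable def hsup (M : DerivedCategory A) : EReal :=
  ⨆ (i : ℤ) (_ : ¬ IsZero ((DerivedCategory.homologyFunctor A i).obj M)), ((i : ℝ) : EReal)

/-- The infimum of the degrees in which the cohomology of `M` does not vanish. -/
noncomputable def hinf (M : DerivedCategory A) : EReal :=
  ⨅ (i : ℤ) (_ : ¬ IsZero ((DerivedCategory.homologyFunctor A i).obj M)), ((i : ℝ) : EReal)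

/-- The `X`-resolution dimension of an object `M` of the derived category with right bounded
cohomology: the infimum of all integers `n` such that `M` is isomorphic, in the derived category,
to a complex concentrated in the degrees `-n, …, sup M` with terms in `X` in these degrees. It is
`⊤` if there is no such `n`, and `⊥` for `M = 0`. (If the cohomology of `M` is not right bounded
then `hsup M = ⊤` and no upper bound is imposed on the degrees.) -/
noncomputable def resolDim (X : ObjectProperty A) (M : DerivedCategory A) : EReal :=
  ⨅ (n : ℤ) (_ : ∃ K : CochainComplex A ℤ,
    Nonempty (DerivedCategory.Q.obj K ≅ M) ∧
    (∀ i : ℤ, i < -n → IsZero (K.X i)) ∧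
    (∀ i : ℤ, hsup M < ((i : ℝ) : EReal) → IsZero (K.X i)) ∧
    (∀ i : ℤ, -n ≤ i → ((i : ℝ) : EReal) ≤ hsup M → X (K.X i))), ((n : ℝ) : EReal)

/-- The projective dimension of an object of the derived category. -/
noncomputable def pd (M : DerivedCategory A) : EReal := resolDim (isProjective A) M

/-- The Gorenstein projective dimension of an object of the derived category. -/
noncomputable def Gpd (M : DerivedCategory A) : EReal := resolDim (Gproj A) M

/-- The essential image in the bounded derived category of a class `X` of objects of `A`, viewed
as complexes concentrated in degree zero. -/
def inDb (X : ObjectProperty A) : ObjectProperty (DerivedCategory.Bounded A) := fun N =>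
  ∃ B : A, X B ∧ Nonempty (N.obj ≅ (DerivedCategory.singleFunctor A 0).obj B)

/-- The `X`-level, in the bounded derived category, of an object of the bounded derived
category. -/
noncomputable def levelDb (X : ObjectProperty A) (M : DerivedCategory.Bounded A) : EReal :=
  level (inDb X) M

/-- The `X`-level, in the bounded derived category, of an arbitrary object `M` of the derived
category: it is `⊤` unless `M` belongs to the bounded derived category. -/
noncomputable def levelDbOfComplex (X : ObjectProperty A) (M : DerivedCategory A) : EReal :=
  ⨅ (N : DerivedCategory.Bounded A) (_ : Nonempty (N.obj ≅ M)), levelDb X N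

end AbelianCategory

section Modules

/-- The totally reflexive modules: finitely generated modules `M` such that the biduality map
`M ⟶ M**` is bijective and `Extⁱ(M, R) = 0 = Extⁱ(M*, R)` for all `i > 0`. -/
def tref (R : Type u) [CommRing R] : ObjectProperty (FGModuleCat.{u} R) := fun M =>
  Module.IsReflexive R M ∧
  (∀ i : ℕ, 0 < i →
    Subsingleton (Abelian.Ext.{u} (ModuleCat.of R M) (ModuleCat.of R R) i)) ∧
  (∀ i : ℕ, 0 < i →
    Subsingleton (Abelian.Ext.{u} (ModuleCat.of R (Module.Dual R M)) (ModuleCat.of R R) i))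

/-- The Gorenstein dimension of an object of the derived category of the category of finitely
generated modules over a commutative noetherian ring: its Gorenstein projective dimension with
respect to that category. -/
noncomputable def Gdim {R : Type u} [CommRing R] [IsNoetherianRing R]
    [HasDerivedCategory.{w} (FGModuleCat.{u} R)] (M : DerivedCategory (FGModuleCat.{u} R)) :
    EReal :=
  Gpd M

end Modules

end LevelBound

/-!
Let `M` be a nonzero object of the bounded derived category with cohomology starting in degree `i`,
let `K` be a resolution of `M` by projectives, and write `C j` for the cokernel `K.opcycles j` of the
differential of `K` ending in degree `j`. The bound says that if `M` belongs to the `(n + 1)`-st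
thickening of `X` then `C (i - n)` belongs to the class `Y` of objects that measures the dimension,
for then truncating `K` in degree `i - n` gives one with terms in `Y`, in degrees `≥ i - n`
(`resolDim_add_hinf_add_one_le`).

The mechanism is the ghost lemma (`thickening_le_killedBy`): a composite of `n + 1` morphisms, each
of which is killed by all morphisms from shifts of objects of `X`, kills all morphisms from `M`. A
morphism from `M` to an object `Z` placed in a degree at most `i - n - 1` factors through `C (i - 1)`
placed in degree `i - 1` (`exists_factor_single`). Replacing `C (i - 1)` successively by its syzygies
turns it into a composite of `n + 1` ghosts followed by another morphism, so it vanishes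
(`comp_eq_zero_of_thickening`), as long as there are no higher extensions from the objects of `X` to
these syzygies. Such vanishing for a morphism to `Z` in degree `j` means that all morphisms
`C j ⟶ Z` extend along the inclusion of `C j` into the next term of `K`
(`IsProjResolution.exists_desc`).

If `X` consists of the projective objects there is no restriction on `Z`. Taking `Z = C (i - n - 1)`
shows that the inclusion of `C (i - n - 1)` splits, so that `C (i - n)` is projective
(`projective_opcycles`).

If `X` consists of Gorenstein projective objects then the argument applies when the syzygies have
finite projective dimension and `Z` is projective. Since the objects whose projective resolutions
have Gorenstein projective cokernels in small degrees form a thick subcategory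
(`gFinite_of_thickening`), the object `C (i - 1)` has finite Gorenstein projective dimension. It
therefore embeds into an object `L` of finite projective dimension with Gorenstein projective
cokernel (`exists_approximation`), and the morphism from `C (i - 1)` to `Z` extends to `L`. The
conclusion is that morphisms from `C j` to projective objects extend to the next term of `K` for
`j < i - n`; this is what is needed to see that with `C j` also `C (j + 1)` is Gorenstein projective
(`SES.gproj₃`), and one climbs from small degrees up to `i - n` (`gproj_opcycles`).

All this holds in an abelian category with enough projectives. For finitely generated modules over a
commutative noetherian ring it remains to see that totally reflexive modules are Gorenstein
projective (`tref_le_gproj`), which follows by splicing syzygies of the module with duals of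
syzygies of its dual.
-/

universe v' u'

namespace LevelBound

open CategoryTheory CategoryTheory.Limits ZeroObject Pretriangulated Triangulated DerivedCategory

/-! ### Morphisms out of complexes of projectives -/

section
variable {A : Type u} [Category.{v} A] [Abelian A]

lemma isZero_single_X (k i : ℤ) (h : i ≠ k) (X : A) :
    IsZero (((HomologicalComplex.single A (ComplexShape.up ℤ) k).obj X).X i) :=
  HomologicalComplex.isZero_single_obj_X _ _ _ _ h

variable [HasDerivedCategory.{w} A]

lemma exists_Q_map_eq (K L : CochainComplex A ℤ) [K.IsKProjective]
    (f : Q.obj K ⟶ Q.obj L) : ∃ g : K ⟶ L, Q.map g = f := by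
  obtain ⟨g, hg⟩ := (CochainComplex.IsKProjective.Qh_map_bijective K
    ((HomotopyCategory.quotient _ _).obj L)).surjective
    ((quotientCompQhIso A).hom.app K ≫ f ≫ (quotientCompQhIso A).inv.app L)
  obtain ⟨g, rfl⟩ := (HomotopyCategory.quotient _ _).map_surjective g
  refine ⟨g, ?_⟩
  have := (quotientCompQhIso A).hom.naturality g
  simp only [Functor.comp_map] at this
  rw [hg] at this
  simpa using this.symm

lemma homotopy_of_Q_map_eq {K L : CochainComplex A ℤ} [K.IsKProjective]
    (f g : K ⟶ L) (h : Q.map f = Q.map g) : Nonempty (Homotopy f g) := by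
  refine ⟨HomotopyCategory.homotopyOfEq _ _
    ((CochainComplex.IsKProjective.Qh_map_bijective K _).injective ?_)⟩
  have h1 := (quotientCompQhIso A).hom.naturality f
  have h2 := (quotientCompQhIso A).hom.naturality g
  rw [h, ← h2] at h1
  exact (cancel_mono _).1 h1

lemma hom_eq_zero_of_disjoint {K L : CochainComplex A ℤ} [K.IsKProjective]
    (h : ∀ n, IsZero (K.X n) ∨ IsZero (L.X n)) (f : Q.obj K ⟶ Q.obj L) : f = 0 := by
  obtain ⟨g, rfl⟩ := exists_Q_map_eq K L f
  have : g = 0 := by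
    ext n
    rcases h n with h | h
    · exact h.eq_of_src _ _
    · exact h.eq_of_tgt _ _
  rw [this, Functor.map_zero]

/-- An object placed in degree `k` is the `-k`-fold shift of the object placed in degree `0`. -/
noncomputable def singleShiftIso (k m : ℤ) (h : m + k = 0) (X : A) :
    ((singleFunctor A 0).obj X)⟦m⟧ ≅ (singleFunctor A k).obj X :=
  ((singleFunctors A).shiftIso m k 0 h).app X

/-- If `K` is a bounded above complex of projectives without cohomology below degree `j`, then
every morphism from `K` to an object placed in a degree `≤ j` factors through the cokernel of the
differential ending in degree `j`: the kernel of the map from the truncation of `K` to that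
cokernel is a complex of projectives in degrees `> j`. -/
lemma exists_factor_single (K : CochainComplex A ℤ) (s j : ℤ) [K.IsStrictlyLE s]
    [∀ n, Projective (K.X n)] [K.IsGE j] {M : DerivedCategory A} (e : Q.obj K ≅ M)
    (m : ℤ) (hk : -j ≤ m) (Z : A) (f : M ⟶ ((singleFunctor A 0).obj Z)⟦m⟧) :
    ∃ (a : M ⟶ ((singleFunctor A 0).obj (K.opcycles j))⟦-j⟧)
      (b : ((singleFunctor A 0).obj (K.opcycles j))⟦-j⟧ ⟶ ((singleFunctor A 0).obj Z)⟦m⟧),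
      f = a ≫ b := by
  let T := K.truncGE j
  let p : T ⟶ (HomologicalComplex.single A (ComplexShape.up ℤ) j).obj (K.opcycles j) :=
    HomologicalComplex.mkHomToSingle (K.truncGEXIsoOpcycles j).hom (fun i hi => by
      apply (T.isZero_of_isStrictlyGE j i (by simp at hi; lia)).eq_of_src)
  have hpj : IsIso (p.f j) := by
    dsimp [p]
    rw [HomologicalComplex.mkHomToSingle_f]
    infer_instance
  have hp : Epi p := by
    refine HomologicalComplex.epi_of_epi_f _ (fun i => ?_)
    by_cases h : i = j
    · subst h; infer_instance
    · exact ⟨fun _ _ _ => (isZero_single_X j i h _).eq_of_src _ _⟩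
  have hS : (ShortComplex.mk (kernel.ι p) p (by simp)).ShortExact :=
    { exact := ShortComplex.exact_kernel p }
  have hSi (i : ℤ) := hS.map_of_exact (HomologicalComplex.eval A (ComplexShape.up ℤ) i)
  let F := kernel p
  have hF1 (i : ℤ) (hi : i ≤ j) : IsZero (F.X i) := by
    by_cases h : i = j
    · subst h
      exact (ShortComplex.ShortExact.isIso_g_iff (hSi i)).1 hpj
    · have : Mono ((kernel.ι p).f i) := (hSi i).mono_f
      exact IsZero.of_mono ((kernel.ι p).f i) (T.isZero_of_isStrictlyGE j i (by lia))
  have hF2 (i : ℤ) (hi : j < i) : IsIso ((kernel.ι p).f i) :=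
    (ShortComplex.ShortExact.isIso_f_iff (hSi i)).2 (isZero_single_X j i (by lia) _)
  have hFp (i : ℤ) : Projective (F.X i) := by
    by_cases h : i ≤ j
    · exact Projective.of_iso ((hF1 i h).iso (isZero_zero A)).symm inferInstance
    · have := hF2 i (by lia)
      exact Projective.of_iso ((K.truncGEXIso j i (by lia)).symm ≪≫
        (asIso ((kernel.ι p).f i)).symm) inferInstance
  have hFs : F.IsStrictlyLE s := by
    rw [CochainComplex.isStrictlyLE_iff]
    intro i hi
    have : Mono ((kernel.ι p).f i) := (hSi i).mono_f
    exact IsZero.of_mono ((kernel.ι p).f i) (T.isZero_of_isStrictlyLE s i hi)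
  have := CochainComplex.isKProjective_of_projective F s
  let π : Q.obj K ⟶ Q.obj T := Q.map (K.πTruncGE j)
  let u := singleShiftIso (-m) m (by simp) Z
  let g : Q.obj T ⟶ Q.obj ((HomologicalComplex.single A (ComplexShape.up ℤ) (-m)).obj Z) :=
    inv π ≫ e.hom ≫ f ≫ u.hom
  have hg : Q.map (kernel.ι p) ≫ g = 0 := by
    apply hom_eq_zero_of_disjoint
    intro n
    by_cases h : n ≤ j
    · exact Or.inl (hF1 n h)
    · exact Or.inr (isZero_single_X _ _ (by lia) _)
  obtain ⟨b, hb⟩ := Triangle.yoneda_exact₂ _ (triangleOfSES_distinguished hS) g hg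
  let t := singleShiftIso j (-j) (by simp) (K.opcycles j)
  let q : Q.obj T ⟶ (singleFunctor A j).obj (K.opcycles j) := Q.map p
  let b' : (singleFunctor A j).obj (K.opcycles j) ⟶ (singleFunctor A (-m)).obj Z := b
  have hb' : g = q ≫ b' := hb
  have hf : f = e.inv ≫ π ≫ g ≫ u.inv := by simp [g]
  refine ⟨e.inv ≫ π ≫ q ≫ t.inv, t.hom ≫ b' ≫ u.inv, ?_⟩
  rw [hf, hb']
  simp

/-! ### Projective resolutions of bounded objects -/

/-- A complex of projectives concentrated in degrees `≤ s` that represents `M`. -/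
structure IsProjResolution (K : CochainComplex A ℤ) (s : ℤ) (M : DerivedCategory A) : Prop where
  isStrictlyLE : K.IsStrictlyLE s
  projective (n : ℤ) : Projective (K.X n)
  nonempty_iso : Nonempty (Q.obj K ≅ M)

lemma IsProjResolution.isKProjective {K : CochainComplex A ℤ} {s : ℤ} {M : DerivedCategory A}
    (h : IsProjResolution K s M) : K.IsKProjective := by
  have := h.isStrictlyLE
  have := h.projective
  exact CochainComplex.isKProjective_of_projective K s

lemma IsProjResolution.of_iso {K : CochainComplex A ℤ} {s : ℤ} {M N : DerivedCategory A}
    (h : IsProjResolution K s M) (e : M ≅ N) : IsProjResolution K s N :=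
  ⟨h.isStrictlyLE, h.projective, h.nonempty_iso.map (· ≪≫ e)⟩

lemma IsProjResolution.mono {K : CochainComplex A ℤ} {s s' : ℤ} {M : DerivedCategory A}
    (h : IsProjResolution K s M) (hs : s ≤ s') : IsProjResolution K s' M :=
  ⟨have := h.isStrictlyLE; K.isStrictlyLE_of_le s s' hs, h.projective, h.nonempty_iso⟩

lemma IsProjResolution.shift {K : CochainComplex A ℤ} {s : ℤ} {M : DerivedCategory A}
    (h : IsProjResolution K s M) (a s' : ℤ) (hs : a + s' = s) :
    IsProjResolution (K⟦a⟧) s' (M⟦a⟧) :=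
  ⟨have := h.isStrictlyLE; K.isStrictlyLE_shift s a s' hs, fun n => h.projective (n + a),
    h.nonempty_iso.map fun e => (Q.commShiftIso a).app K ≪≫ (shiftFunctor _ a).mapIso e⟩

/-- The mapping cone of a morphism between projective resolutions of the first two objects of a
distinguished triangle is a projective resolution of the third one. -/
lemma IsProjResolution.exists_mappingCone {K L : CochainComplex A ℤ} {s : ℤ}
    {T : Triangle (DerivedCategory A)} (hT : T ∈ distTriang (DerivedCategory A))
    (hK : IsProjResolution K (s + 1) T.obj₁) (hL : IsProjResolution L s T.obj₂) :
    ∃ φ : K ⟶ L, IsProjResolution (CochainComplex.mappingCone φ) s T.obj₃ := by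
  have := hK.isKProjective
  obtain ⟨e₁⟩ := hK.nonempty_iso
  obtain ⟨e₂⟩ := hL.nonempty_iso
  obtain ⟨φ, hφ⟩ := exists_Q_map_eq K L (e₁.hom ≫ T.mor₁ ≫ e₂.inv)
  refine ⟨φ, ?_, fun n => ?_, ?_⟩
  · rw [CochainComplex.isStrictlyLE_iff]
    intro i hi
    have := hK.isStrictlyLE
    have := hL.isStrictlyLE
    refine IsZero.of_iso ?_ (HomologicalComplex.homotopyCofiber.XIsoBiprod φ i (i + 1) rfl)
    rw [biprod_isZero_iff]
    exact ⟨K.isZero_of_isStrictlyLE (s + 1) _ (by lia), L.isZero_of_isStrictlyLE s _ hi⟩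
  · have := hK.projective
    have := hL.projective
    exact Projective.of_iso (HomologicalComplex.homotopyCofiber.XIsoBiprod φ n (n + 1) rfl).symm
      inferInstance
  · exact ⟨Triangle.π₃.mapIso (isoTriangleOfIso₁₂ _ _ (mappingCone_triangle_distinguished φ) hT
      e₁ e₂ (by
        change Q.map φ ≫ e₂.hom = e₁.hom ≫ T.mor₁
        rw [hφ]; simp))⟩

lemma exists_projResolution_single [EnoughProjectives A] (X : A) :
    ∃ K, IsProjResolution K 0 ((singleFunctor A 0).obj X) := by
  let P := ProjectiveResolution.of X
  have e : Q.obj P.cochainComplex ≅ Q.obj ((CochainComplex.singleFunctor A 0).obj X) :=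
    asIso (Q.map P.π')
  exact ⟨P.cochainComplex, inferInstance, inferInstance, ⟨e⟩⟩

/-- A bounded object of the derived category has a projective resolution that ends in the
highest degree allowed by its cohomology; `n` is the number of degrees from `a` to `s`. -/
lemma exists_projResolution [EnoughProjectives A] (a : ℤ) (n : ℕ) (s : ℤ) (hs : s + 1 = a + n)
    (M : DerivedCategory A) [M.IsGE a] [M.IsLE s] : ∃ K, IsProjResolution K s M := by
  induction n generalizing s M with
  | zero =>
    have hM : IsZero M := TStructure.t.isZero M s a (by lia)
    have h0 (i : ℤ) : IsZero ((0 : CochainComplex A ℤ).X i) :=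
      (HomologicalComplex.eval A _ i).map_isZero (isZero_zero _)
    exact ⟨0, by rw [CochainComplex.isStrictlyLE_iff]; exact fun i _ => h0 i,
      fun i => Projective.of_iso ((h0 i).iso (isZero_zero A)).symm inferInstance,
      ⟨(Functor.map_isZero Q (isZero_zero _)).iso hM⟩⟩
  | succ n ih =>
    -- `M` is the cone of a morphism to its truncation below degree `s` from a shift of its
    -- cohomology in degree `s`
    obtain ⟨X, Y, hX, hY, f, g, h, hT⟩ := TStructure.t.exists_triangle M (s - 1) s (by lia)
    have : X.IsLE (s - 1) := ⟨hX⟩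
    have : Y.IsGE s := ⟨hY⟩
    have : Y.IsLE s := TStructure.t.isLE₂ _ (rot_of_distTriang _ hT) s ‹_›
      (have := TStructure.t.isLE_shift X (s - 1) 1 (s - 2)
       TStructure.t.isLE_of_le (X⟦(1 : ℤ)⟧) (s - 2) s)
    have hT' := inv_rot_of_distTriang _ hT
    have : X.IsGE a := TStructure.t.isGE₂ _ hT' a
      (have := TStructure.t.isGE_shift Y s (-1) (s + 1)
       TStructure.t.isGE_of_ge (Y⟦(-1 : ℤ)⟧) a (s + 1)) ‹_›
    obtain ⟨K, hK⟩ := ih (s - 1) (by lia) X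
    obtain ⟨H, ⟨e⟩⟩ := exists_iso_singleFunctor_obj_of_isGE_of_isLE Y s
    obtain ⟨L, hL⟩ := exists_projResolution_single H
    have hL' : IsProjResolution (L⟦-s⟧⟦(-1 : ℤ)⟧) (s + 1) (Y⟦(-1 : ℤ)⟧) :=
      ((hL.shift (-s) s (by simp)).of_iso
        (singleShiftIso s (-s) (by simp) H ≪≫ e.symm)).shift (-1) (s + 1) (by lia)
    obtain ⟨φ, hφ⟩ := IsProjResolution.exists_mappingCone hT' hL' (hK.mono (by lia))
    exact ⟨_, hφ⟩

end

/-! ### Thickenings and composites of ghost maps -/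

section
variable {T : Type u} [Category.{v} T] [HasZeroObject T] [HasShift T ℤ] [Preadditive T]
  [∀ n : ℤ, (shiftFunctor T n).Additive] [Pretriangulated T]

lemma span_le {P Z : ObjectProperty T} [Z.IsStableUnderShift ℤ] [Z.IsStableUnderRetracts]
    (hZ : ∀ (k : ℕ) (F : Fin k → T), (∀ i, Z (F i)) → Z (⨁ F)) (h : P ≤ Z) : span P ≤ Z := by
  rintro M ⟨k, F, N, hF, ⟨e⟩⟩
  refine ObjectProperty.IsStableUnderRetracts.of_biprod_left Z
    (Z.prop_of_iso e.symm (hZ k F fun i => ?_))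
  exact (ObjectProperty.shiftClosure_le_iff P Z).2 h _ (hF i)

lemma thickening_le {P Z : ObjectProperty T} [Z.IsTriangulated] [Z.IsStableUnderRetracts]
    (h : P ≤ Z) (n : ℕ) : thickening P n ≤ Z := by
  have hZ (k : ℕ) (F : Fin k → T) (hF : ∀ i, Z (F i)) : Z (⨁ F) :=
    Z.prop_of_iso (biproduct.isoProduct F).symm (Z.prop_product hF)
  induction n with
  | zero => exact fun M hM => Z.prop_of_isZero hM
  | succ n ih =>
    cases n with
    | zero => exact span_le hZ h
    | succ n =>
      refine span_le hZ ?_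
      rintro M ⟨X, Y, f, g, δ, hT, hX, hY⟩
      exact Z.ext_of_isTriangulatedClosed₂ _ hT (ih _ hX) (span_le hZ h _ hY)

variable {D : Type u'} [Category.{v'} D] [HasShift D ℤ] [Preadditive D]
  [∀ n : ℤ, (shiftFunctor D n).Additive]

/-- A morphism is a ghost for `X` if it is killed by precomposition with every morphism from a
shift of an object of `X`. -/
def IsGhost (X : ObjectProperty D) : MorphismProperty D := fun U _ f =>
  ∀ N, X N → ∀ (m : ℤ) (g : N⟦m⟧ ⟶ U), g ≫ f = 0

/-- The morphisms that are composites of `n` ghosts for `X`. -/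
def GhostComp (X : ObjectProperty D) : ℕ → MorphismProperty D
  | 0 => ⊤
  | n + 1 => fun U V f => ∃ (W : D) (g : U ⟶ W) (h : W ⟶ V),
      GhostComp X n g ∧ IsGhost X h ∧ f = g ≫ h

/-- The objects `E` such that every composite of `n` ghosts kills all morphisms from the shifts of
the image of `E` under the functor `F`. -/
def KilledBy (X : ObjectProperty D) (F : T ⥤ D) (n : ℕ) : ObjectProperty T := fun E =>
  ∀ (m : ℤ) (U V : D) (f : U ⟶ V), GhostComp X n f → ∀ a : (F.obj E)⟦m⟧ ⟶ U, a ≫ f = 0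

variable (X : ObjectProperty D) (F : T ⥤ D)

instance (n : ℕ) : (KilledBy X F n).IsStableUnderRetracts where
  of_retract {E E'} r h m U V f hf a := by
    have := h m U V f hf ((F.map r.r)⟦m⟧' ≫ a)
    rw [← Category.id_comp a, ← (shiftFunctor D m).map_id, ← F.map_id, ← r.retract, F.map_comp,
      Functor.map_comp, Category.assoc, Category.assoc, ← Category.assoc _ a f, this, comp_zero]

instance (n : ℕ) [F.CommShift ℤ] : (KilledBy X F n).IsStableUnderShift ℤ where
  isStableUnderShiftBy b := ⟨fun E h m U V f hf a => by
    let e : (F.obj (E⟦b⟧))⟦m⟧ ≅ (F.obj E)⟦b + m⟧ :=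
      (shiftFunctor D m).mapIso ((F.commShiftIso b).app E) ≪≫
        (shiftFunctorAdd D b m).symm.app (F.obj E)
    have := h (b + m) U V f hf (e.inv ≫ a)
    rw [Category.assoc] at this
    exact (cancel_epi e.inv).1 (this.trans comp_zero.symm)⟩

lemma killedBy_biproduct [F.Additive] (n k : ℕ) (G : Fin k → T)
    (h : ∀ i, KilledBy X F n (G i)) : KilledBy X F n (⨁ G) := by
  intro m U V f hf a
  rw [← Category.id_comp a, ← (shiftFunctor D m).map_id, ← F.map_id, ← biproduct.total, F.map_sum,
    Functor.map_sum, Preadditive.sum_comp, Preadditive.sum_comp]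
  refine Finset.sum_eq_zero fun i _ => ?_
  have := h i m U V f hf ((F.map (biproduct.ι G i))⟦m⟧' ≫ a)
  rw [F.map_comp, Functor.map_comp, Category.assoc, Category.assoc,
    ← Category.assoc _ a f, this, comp_zero]

variable [HasZeroObject D] [Pretriangulated D]

/-- The exactness of a shifted distinguished triangle, without the sign carried by its maps. -/
lemma exists_shift_factor₂ {S : Triangle D} (hS : S ∈ distTriang D) (m : ℤ) {U : D}
    (f : S.obj₂⟦m⟧ ⟶ U) (hf : S.mor₁⟦m⟧' ≫ f = 0) : ∃ g : S.obj₃⟦m⟧ ⟶ U, f = S.mor₂⟦m⟧' ≫ g := by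
  obtain ⟨g, hg⟩ := Triangle.yoneda_exact₂ _ (Triangle.shift_distinguished _ hS m) f (by
    change (m.negOnePow • S.mor₁⟦m⟧') ≫ f = 0
    rw [Linear.units_smul_comp, hf, smul_zero])
  let g' : S.obj₃⟦m⟧ ⟶ U := g
  have hg' : f = (m.negOnePow • S.mor₂⟦m⟧') ≫ g' := hg
  exact ⟨m.negOnePow • g', by rw [hg', Linear.units_smul_comp, Linear.comp_units_smul]⟩

lemma exists_shift_factor₃ {S : Triangle D} (hS : S ∈ distTriang D) (m m' : ℤ) (hm : m + 1 = m')
    {U : D} (f : S.obj₃⟦m⟧ ⟶ U) (hf : S.mor₂⟦m⟧' ≫ f = 0) :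
    ∃ (h : S.obj₃⟦m⟧ ⟶ S.obj₁⟦m'⟧) (g : S.obj₁⟦m'⟧ ⟶ U), f = h ≫ g := by
  obtain ⟨g, hg⟩ := Triangle.yoneda_exact₃ _ (Triangle.shift_distinguished _ hS m) f (by
    change (m.negOnePow • S.mor₂⟦m⟧') ≫ f = 0
    rw [Linear.units_smul_comp, hf, smul_zero])
  let e : S.obj₁⟦m⟧⟦(1 : ℤ)⟧ ≅ S.obj₁⟦m'⟧ := (shiftFunctorAdd' D m 1 m' hm).symm.app S.obj₁
  let δ : S.obj₃⟦m⟧ ⟶ S.obj₁⟦m⟧⟦(1 : ℤ)⟧ := ((Triangle.shiftFunctor D m).obj S).mor₃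
  let g' : S.obj₁⟦m⟧⟦(1 : ℤ)⟧ ⟶ U := g
  have hg' : f = δ ≫ g' := hg
  exact ⟨δ ≫ e.hom, e.inv ≫ g', by rw [hg']; simp⟩

/-- The ghost lemma: a composite of `n` ghosts kills all morphisms from an object of the `n`-th
thickening. -/
lemma thickening_le_killedBy {P : ObjectProperty T} [F.CommShift ℤ] [F.IsTriangulated]
    (h : ∀ E, P E → X (F.obj E)) (n : ℕ) : thickening P n ≤ KilledBy X F n := by
  have hspan {m : ℕ} {P' : ObjectProperty T} (h' : P' ≤ KilledBy X F m) :
      span P' ≤ KilledBy X F m := span_le (killedBy_biproduct X F m) h'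
  have hone : span P ≤ KilledBy X F 1 := by
    refine hspan fun E hE m U V f hf a => ?_
    obtain ⟨W, g, h', -, hh, rfl⟩ := hf
    rw [← Category.assoc]
    exact hh _ (h _ hE) m (a ≫ g)
  induction n with
  | zero =>
    intro M hM m U V f _ a
    exact ((shiftFunctor D m).map_isZero (F.map_isZero hM)).eq_of_src _ _
  | succ n ih =>
    cases n with
    | zero => exact hone
    | succ n =>
      refine hspan ?_
      rintro M ⟨E, B, f, g, δ, hT, hE, hB⟩ m U V φ ⟨W, φ₁, φ₂, h₁, h₂, rfl⟩ a
      have hfac : ∃ b : (F.obj B)⟦m⟧ ⟶ W, a ≫ φ₁ = (F.map g)⟦m⟧' ≫ b :=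
        exists_shift_factor₂ (F.map_distinguished _ hT) m (a ≫ φ₁)
          (show (F.map f)⟦m⟧' ≫ a ≫ φ₁ = 0 by
            rw [← Category.assoc]
            exact ih _ hE m U W φ₁ h₁ _)
      obtain ⟨b, hb⟩ := hfac
      have := hone _ hB m W V φ₂ ⟨W, 𝟙 _, φ₂, trivial, h₂, by simp⟩ b
      rw [← Category.assoc, hb, Category.assoc, this, comp_zero]
end

/-! ### Vanishing of extensions -/

section
variable {A : Type u} [Category.{v} A] [Abelian A]

/-- The morphisms `f` and `g` form a short exact sequence `0 ⟶ X ⟶ Y ⟶ Z ⟶ 0`. -/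
def SES {X Y Z : A} (f : X ⟶ Y) (g : Y ⟶ Z) : Prop :=
  ∃ w : f ≫ g = 0, (ShortComplex.mk f g w).ShortExact

/-- Every morphism from the source of `f` to a projective object extends along `f`. -/
def ExtendsToProj {X Y : A} (f : X ⟶ Y) : Prop :=
  ∀ Q : A, Projective Q → ∀ a : X ⟶ Q, ∃ b : Y ⟶ Q, f ≫ b = a

variable [HasDerivedCategory.{w} A]

/-- The group `Extⁿ(X, Y)`, in the form of morphisms in the derived category, vanishes. -/
def ExtVanish (X Y : A) (n : ℤ) : Prop :=
  ∀ f : (singleFunctor A 0).obj X ⟶ ((singleFunctor A 0).obj Y)⟦n⟧, f = 0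

lemma ExtVanish.eq_zero {X Y : A} {n : ℤ} (h : ExtVanish X Y n) (a b : ℤ) (hab : a + n = b)
    (f : ((singleFunctor A 0).obj X)⟦a⟧ ⟶ ((singleFunctor A 0).obj Y)⟦b⟧) : f = 0 := by
  let e := (shiftFunctorAdd' (DerivedCategory A) n a b (by lia)).app ((singleFunctor A 0).obj Y)
  obtain ⟨g, hg⟩ := (shiftFunctor (DerivedCategory A) a).map_surjective (f ≫ e.hom)
  rw [← cancel_mono e.hom, ← hg, h g, Functor.map_zero, zero_comp]

lemma ExtVanish.eq_zero' {X Y : A} {n : ℤ} (h : ExtVanish X Y n) (a : ℤ) (hab : a + n = 0)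
    (f : ((singleFunctor A 0).obj X)⟦a⟧ ⟶ (singleFunctor A 0).obj Y) : f = 0 := by
  rw [← cancel_mono ((shiftFunctorZero (DerivedCategory A) ℤ).inv.app _), zero_comp]
  exact h.eq_zero a 0 hab _

lemma ExtVanish.eq_zero_add {X Y : A} {n : ℤ} (h : ExtVanish X Y n) (a b c : ℤ)
    (hab : a + n = b + c)
    (f : ((singleFunctor A 0).obj X)⟦a⟧ ⟶ ((singleFunctor A 0).obj Y)⟦b⟧⟦c⟧) : f = 0 := by
  rw [← cancel_mono ((shiftFunctorAdd (DerivedCategory A) b c).inv.app _), zero_comp]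
  exact h.eq_zero a _ hab _

lemma ExtVanish.eq_zero_zero {X Y : A} {n : ℤ} (h : ExtVanish X Y n) (b c : ℤ)
    (hab : n = b + c)
    (f : (singleFunctor A 0).obj X ⟶ ((singleFunctor A 0).obj Y)⟦b⟧⟦c⟧) : f = 0 := by
  rw [← cancel_epi ((shiftFunctorZero (DerivedCategory A) ℤ).hom.app _), comp_zero]
  exact h.eq_zero_add 0 b c (by lia) _

lemma extVanish_of_projective (X Y : A) [Projective X] {n : ℤ} (hn : 1 ≤ n) :
    ExtVanish X Y n := by
  intro f
  let K : CochainComplex A ℤ := (HomologicalComplex.single A (ComplexShape.up ℤ) 0).obj X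
  have hK (i : ℤ) : Projective (K.X i) := by
    by_cases h : i = 0
    · subst h
      exact Projective.of_iso
        (HomologicalComplex.singleObjXSelf (ComplexShape.up ℤ) 0 X).symm inferInstance
    · exact Projective.of_iso ((isZero_single_X 0 i h X).iso (isZero_zero A)).symm inferInstance
  have : K.IsStrictlyLE 0 := by
    rw [CochainComplex.isStrictlyLE_iff]
    exact fun i hi => isZero_single_X 0 i (by lia) X
  have := CochainComplex.isKProjective_of_projective K 0
  let u := singleShiftIso (-n) n (by simp) Y
  let g : Q.obj K ⟶ Q.obj ((HomologicalComplex.single A (ComplexShape.up ℤ) (-n)).obj Y) :=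
    f ≫ u.hom
  have hg : f ≫ u.hom = 0 := hom_eq_zero_of_disjoint (K := K) (fun i => by
    by_cases h : i = 0
    · exact Or.inr (isZero_single_X _ _ (by lia) _)
    · exact Or.inl (isZero_single_X _ _ h _)) g
  rw [← cancel_mono u.hom, hg, zero_comp]

variable {X Y Z : A} {f : X ⟶ Y} {g : Y ⟶ Z}

lemma SES.exists_triangle (h : SES f g) :
    ∃ δ : (singleFunctor A 0).obj Z ⟶ ((singleFunctor A 0).obj X)⟦(1 : ℤ)⟧,
      Triangle.mk ((singleFunctor A 0).map f) ((singleFunctor A 0).map g) δ ∈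
        distTriang (DerivedCategory A) :=
  ⟨h.choose_spec.singleδ, h.choose_spec.singleTriangle_distinguished⟩

/- In the lemmas on the vanishing of extensions, the index is the position in the short exact
sequence of the object for which it is shown. -/

lemma SES.extVanish₂ (h : SES f g) {W : A} {n : ℤ} (h₁ : ExtVanish X W n)
    (h₃ : ExtVanish Z W n) : ExtVanish Y W n := by
  intro φ
  obtain ⟨δ, hT⟩ := h.exists_triangle
  obtain ⟨ψ, hψ⟩ := Triangle.yoneda_exact₂ _ hT φ (h₁ _)
  obtain rfl : ψ = 0 := h₃ ψ
  exact hψ.trans comp_zero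

lemma SES.extVanish₁ (h : SES f g) {W : A} {n : ℤ} (h₂ : ExtVanish Y W n)
    (h₃ : ExtVanish Z W (n + 1)) : ExtVanish X W n := by
  intro φ
  obtain ⟨δ, hT⟩ := h.exists_triangle
  obtain ⟨ψ, hψ⟩ := Triangle.yoneda_exact₃ _ (rot_of_distTriang _ hT) (φ⟦(1 : ℤ)⟧')
    (h₃.eq_zero_zero n 1 rfl _)
  obtain rfl : ψ = 0 := h₂.eq_zero_add 1 n 1 (by lia) ψ
  apply (shiftFunctor (DerivedCategory A) (1 : ℤ)).map_injective
  exact (hψ.trans comp_zero).trans (Functor.map_zero _ _ _).symm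

lemma SES.extVanish₃ (h : SES f g) {W : A} {n : ℤ} (h₂ : ExtVanish Y W (n + 1))
    (h₁ : ExtVanish X W n) : ExtVanish Z W (n + 1) := by
  intro φ
  obtain ⟨δ, hT⟩ := h.exists_triangle
  obtain ⟨ψ, hψ⟩ := Triangle.yoneda_exact₃ _ hT φ (h₂ _)
  obtain rfl : ψ = 0 := h₁.eq_zero 1 _ (by lia) ψ
  exact hψ.trans comp_zero

lemma SES.extVanish_target₃ (h : SES f g) {W : A} {n : ℤ} (h₂ : ExtVanish W Y n)
    (h₁ : ExtVanish W X (n + 1)) : ExtVanish W Z n := by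
  intro φ
  obtain ⟨δ, hT⟩ := h.exists_triangle
  obtain ⟨ψ, hψ⟩ := Triangle.coyoneda_exact₃ _ (Triangle.shift_distinguished _ hT n) φ
    (h₁.eq_zero_zero n 1 rfl _)
  obtain rfl : ψ = 0 := h₂ ψ
  exact hψ.trans zero_comp

lemma SES.extendsToProj (h : SES f g) (h₃ : ∀ W : A, Projective W → ExtVanish Z W 1) :
    ExtendsToProj f := by
  intro W hW a
  obtain ⟨δ, hT⟩ := h.exists_triangle
  obtain ⟨ψ, hψ⟩ := Triangle.yoneda_exact₂ _ (inv_rot_of_distTriang _ hT)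
    ((singleFunctor A 0).map a) ((h₃ W hW).eq_zero' (-1) (by lia) _)
  obtain ⟨b, rfl⟩ := (singleFunctor A 0).map_surjective ψ
  refine ⟨b, (singleFunctor A 0).map_injective ?_⟩
  rw [Functor.map_comp]
  exact hψ.symm

/-- The connecting map to the first extensions of `Z` by `W` vanishes on the morphisms that extend
along `f`. -/
lemma SES.extVanish_one (h : SES f g) {W : A} (hW : Projective W) (hf : ExtendsToProj f)
    (h₂ : ExtVanish Y W 1) : ExtVanish Z W 1 := by
  intro φ
  obtain ⟨δ, hT⟩ := h.exists_triangle
  obtain ⟨ψ, hψ⟩ : ∃ ψ : ((singleFunctor A 0).obj X)⟦(1 : ℤ)⟧ ⟶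
      ((singleFunctor A 0).obj W)⟦(1 : ℤ)⟧, φ = δ ≫ ψ := Triangle.yoneda_exact₃ _ hT φ (h₂ _)
  obtain ⟨a, ha⟩ := (shiftFunctor (DerivedCategory A) (1 : ℤ)).map_surjective ψ
  obtain ⟨a, rfl⟩ := (singleFunctor A 0).map_surjective a
  obtain ⟨b, rfl⟩ := hf W hW a
  have h0 : δ ≫ ((singleFunctor A 0).map f)⟦(1 : ℤ)⟧' = 0 := comp_distTriang_mor_zero₃₁ _ hT
  rw [hψ, ← ha, Functor.map_comp, Functor.map_comp, ← Category.assoc, h0, zero_comp]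

/-- Dimension shifting: `Z` may be replaced by a syzygy of it. -/
lemma SES.exists_factor (h : SES f g) [Projective Y] {W : A} (a b a' : ℤ) (hab : a < b)
    (ha' : a + 1 = a')
    (φ : ((singleFunctor A 0).obj Z)⟦a⟧ ⟶ ((singleFunctor A 0).obj W)⟦b⟧) :
    ∃ (ψ : ((singleFunctor A 0).obj Z)⟦a⟧ ⟶ ((singleFunctor A 0).obj X)⟦a'⟧)
      (χ : ((singleFunctor A 0).obj X)⟦a'⟧ ⟶ ((singleFunctor A 0).obj W)⟦b⟧), φ = ψ ≫ χ := by
  obtain ⟨δ, hT⟩ := h.exists_triangle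
  exact exists_shift_factor₃ hT a a' ha' φ
    ((extVanish_of_projective Y W (n := b - a) (by lia)).eq_zero a b (by lia) _)

/-! ### Ghosts with values in an object of the abelian category -/

/-- The objects isomorphic in the derived category to an object of `X` in degree `0`. -/
def singleClass (X : ObjectProperty A) : ObjectProperty (DerivedCategory A) := fun N =>
  ∃ B : A, X B ∧ Nonempty (N ≅ (singleFunctor A 0).obj B)

instance (X : A) (m : ℤ) : (((singleFunctor A 0).obj X)⟦m⟧).IsGE (-m) :=
  TStructure.t.isGE_shift _ 0 m (-m) (by lia)

instance (X : A) (m : ℤ) : (((singleFunctor A 0).obj X)⟦m⟧).IsLE (-m) :=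
  TStructure.t.isLE_shift _ 0 m (-m) (by lia)

lemma isGhost_of_extVanish {X : ObjectProperty A} {N : A}
    (hN : ∀ B, X B → ∀ n : ℤ, 1 ≤ n → ExtVanish B N n) {U : DerivedCategory A} (k : ℤ)
    (hU : U.IsGE (1 - k)) (f : U ⟶ ((singleFunctor A 0).obj N)⟦k⟧) :
    IsGhost (singleClass X) f := by
  rintro V ⟨B, hB, ⟨e⟩⟩ m g
  let e' := (shiftFunctor (DerivedCategory A) m).mapIso e
  rw [← cancel_epi e'.inv, comp_zero]
  by_cases h : k ≤ m
  · have : e'.inv ≫ g = 0 := TStructure.t.zero _ (-m) (1 - k) (by lia)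
    rw [← Category.assoc, this, zero_comp]
  · exact (hN B hB (k - m) (by lia)).eq_zero m k (by lia) _

/-- Let `Y` be a class of objects that is closed under syzygies and receives no higher extensions
from `X`. If `M` belongs to the `(n + 1)`-st thickening of `X` and has no cohomology below degree
`i`, then a morphism from `M` to an object in degree `≤ i - n - 1` vanishes when it factors through
an object of `Y` in degree `i - 1`: by dimension shifting it is a composite of `n + 1` ghosts
followed by another morphism. -/
lemma comp_eq_zero_of_thickening {X Y : ObjectProperty A}
    (hXY : ∀ B N, X B → Y N → ∀ n : ℤ, 1 ≤ n → ExtVanish B N n)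
    (hY : ∀ N, Y N → ∃ (N' P : A) (i : N' ⟶ P) (p : P ⟶ N), Projective P ∧ SES i p ∧ Y N')
    (n : ℕ) (M : Bounded A) (hM : thickening (inDb X) (n + 1) M) (i : ℤ) [hi : M.obj.IsGE i]
    {N : A} (hN : Y N) (f : M.obj ⟶ ((singleFunctor A 0).obj N)⟦1 - i⟧) {Z : A} {m : ℤ}
    (hm : n + 1 - i ≤ m)
    (g : ((singleFunctor A 0).obj N)⟦1 - i⟧ ⟶ ((singleFunctor A 0).obj Z)⟦m⟧) :
    f ≫ g = 0 := by
  have key (r : ℕ) : r ≤ n → ∃ (N' : A) (k : ℤ) (h : M.obj ⟶ ((singleFunctor A 0).obj N')⟦k⟧)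
      (g' : ((singleFunctor A 0).obj N')⟦k⟧ ⟶ ((singleFunctor A 0).obj Z)⟦m⟧),
      k = r + 1 - i ∧ Y N' ∧ GhostComp (singleClass X) (r + 1) h ∧ f ≫ g = h ≫ g' := by
    induction r with
    | zero =>
      intro _
      exact ⟨N, 1 - i, f, g, by simp, hN, ⟨_, 𝟙 _, f, trivial,
        isGhost_of_extVanish (fun B hB => hXY B N hB hN) (1 - i)
          (by simpa using hi) f, by simp⟩, rfl⟩
    | succ r ih =>
      intro hr
      obtain ⟨N₁, k, h, g', rfl, hN₁, hh, hfg⟩ := ih (by lia)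
      obtain ⟨N₂, P, j, p, hP, hS, hN₂⟩ := hY N₁ hN₁
      obtain ⟨ψ, χ, rfl⟩ := hS.exists_factor (r + 1 - i) m (r + 1 + 1 - i) (by lia) (by lia) g'
      refine ⟨N₂, _, h ≫ ψ, χ, by push_cast; ring, hN₂, ⟨_, h, ψ, hh, ?_, rfl⟩, by simp [hfg]⟩
      exact isGhost_of_extVanish (fun B hB => hXY B N₂ hB hN₂) _
        (TStructure.t.isGE_of_ge _ _ (-(r + 1 - i)) (by lia)) ψ
  obtain ⟨N', k, h, g', -, -, hh, hfg⟩ := key n le_rfl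
  have hk := thickening_le_killedBy (singleClass X) (Bounded.ι (C := A))
    (P := inDb X) (fun E hE => hE) (n + 1) M hM 0 _ _ h hh
    ((shiftFunctorZero (DerivedCategory A) ℤ).hom.app M.obj)
  rw [hfg, (cancel_epi _).1 (hk.trans comp_zero.symm), zero_comp]
end

/-! ### Short exact sequences -/

section
variable {A : Type u} [Category.{v} A] [Abelian A]

section
variable {X Y Z : A} {f : X ⟶ Y} {g : Y ⟶ Z}

lemma SES.mono (h : SES f g) : Mono f := h.choose_spec.mono_f

lemma SES.epi (h : SES f g) : Epi g := h.choose_spec.epi_g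

lemma SES.zero (h : SES f g) : f ≫ g = 0 := h.choose

lemma SES.exists_desc (h : SES f g) {W : A} (t : Y ⟶ W) (ht : f ≫ t = 0) :
    ∃ t' : Z ⟶ W, g ≫ t' = t :=
  have := h.epi
  ⟨h.choose_spec.exact.desc t ht, h.choose_spec.exact.g_desc t ht⟩

lemma SES.exists_lift (h : SES f g) {W : A} (t : W ⟶ Y) (ht : t ≫ g = 0) :
    ∃ t' : W ⟶ X, t' ≫ f = t :=
  have := h.mono
  ⟨h.choose_spec.exact.lift t ht, h.choose_spec.exact.lift_f t ht⟩

lemma SES.of_exists_desc [Mono f] [Epi g] (w : f ≫ g = 0)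
    (h : ∀ {W : A} (t : Y ⟶ W), f ≫ t = 0 → ∃ t' : Z ⟶ W, g ≫ t' = t) : SES f g :=
  ⟨w, { exact := ShortComplex.exact_of_g_is_cokernel _
          (CokernelCofork.IsColimit.ofπ g w (fun t ht => (h t ht).choose)
            (fun t ht => (h t ht).choose_spec)
            (fun t ht m hm => by rw [← cancel_epi g, hm, (h t ht).choose_spec])) }⟩

lemma SES.of_isPushout (h : SES f g) {X' W : A} {j : X ⟶ X'} {b : Y ⟶ W} {a : X' ⟶ W}
    (sq : IsPushout f j b a) : ∃ c : W ⟶ Z, SES a c := by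
  have := h.mono
  have := h.epi
  have : Mono a := Abelian.mono_inr_of_isColimit f j sq.isColimit
  let c : W ⟶ Z := sq.desc g 0 (by simp [h.zero])
  have hc : b ≫ c = g := sq.inl_desc _ _ _
  have : Epi c := epi_of_epi_fac hc
  refine ⟨c, SES.of_exists_desc (sq.inr_desc _ _ _) fun t ht => ?_⟩
  obtain ⟨t', ht'⟩ := h.exists_desc (b ≫ t) (by
    rw [← Category.assoc, sq.w, Category.assoc, ht, comp_zero])
  refine ⟨t', sq.hom_ext ?_ ?_⟩
  · rw [← Category.assoc, hc, ht']
  · rw [ht, ← Category.assoc, sq.inr_desc, zero_comp]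

/-- The pushout of a short exact sequence along a monomorphism fits into two short exact
sequences. -/
lemma SES.exists_pushout (h : SES f g) {P Z' : A} {j : X ⟶ P} {q : P ⟶ Z'} (h' : SES j q) :
    ∃ (W : A) (a : P ⟶ W) (c : W ⟶ Z) (b : Y ⟶ W) (d : W ⟶ Z'), SES a c ∧ SES b d := by
  obtain ⟨c, hc⟩ := h.of_isPushout (IsPushout.of_hasPushout f j)
  obtain ⟨d, hd⟩ := h'.of_isPushout (IsPushout.of_hasPushout f j).flip
  exact ⟨_, _, c, _, d, hc, hd⟩

/-- The cokernel of a composite of two monomorphisms is an extension of their cokernels. -/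
lemma SES.exists_comp (h : SES f g) {Y' Z' : A} {j : Y ⟶ Y'} {q : Y' ⟶ Z'} (h' : SES j q) :
    ∃ (W : A) (r : Y' ⟶ W) (s : Z ⟶ W) (t : W ⟶ Z'), SES (f ≫ j) r ∧ SES s t := by
  have sq := IsPushout.of_hasPushout j g
  obtain ⟨t, ht⟩ := h'.of_isPushout sq
  have := h.mono
  have := h'.mono
  have := h.epi
  refine ⟨_, _, _, t, SES.of_exists_desc (g := pushout.inl j g) ?_ fun x hx => ?_, ht⟩
  · rw [Category.assoc, sq.w, ← Category.assoc, h.zero, zero_comp]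
  · obtain ⟨y, hy⟩ := h.exists_desc (j ≫ x) (by rw [← Category.assoc, hx])
    exact ⟨sq.desc x y hy.symm, sq.inl_desc _ _ _⟩

lemma SES.nonempty_retract (h : SES f g) (r : Y ⟶ X) (hr : f ≫ r = 𝟙 X) :
    Nonempty (Retract Z Y) := by
  have := h.epi
  obtain ⟨s, hs⟩ := h.exists_desc (𝟙 Y - r ≫ f) (by
    rw [Preadditive.comp_sub, ← Category.assoc, hr]; simp)
  refine ⟨⟨s, g, ?_⟩⟩
  rw [← cancel_epi g, ← Category.assoc, hs, Preadditive.sub_comp, Category.assoc, h.zero]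
  simp

/-- Adding `V` to the first two terms of a short exact sequence. -/
lemma SES.biprod_map_id (h : SES f g) (V : A) :
    SES (biprod.map f (𝟙 V)) ((biprod.fst : Y ⊞ V ⟶ Y) ≫ g) := by
  have := h.mono
  have := h.epi
  have : Mono (biprod.map f (𝟙 V)) := ⟨fun a b hab => by
    ext
    · have := congrArg (· ≫ biprod.fst) hab
      simpa [← cancel_mono f] using this
    · have := congrArg (· ≫ biprod.snd) hab
      simpa using this⟩
  refine SES.of_exists_desc (by simp [h.zero]) fun t ht => ?_
  obtain ⟨y, hy⟩ := h.exists_desc (biprod.inl ≫ t) (by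
    have := congrArg (biprod.inl ≫ ·) ht
    simpa using this)
  refine ⟨y, ?_⟩
  have h2 : biprod.inr ≫ t = 0 := by
    have := congrArg (biprod.inr ≫ ·) ht
    simpa using this
  ext
  · simp [hy]
  · simp [h2]

lemma SES.of_biprod (X Y : A) : SES (biprod.inl : X ⟶ X ⊞ Y) (biprod.snd : X ⊞ Y ⟶ Y) :=
  SES.of_exists_desc (by simp) fun t ht => ⟨biprod.inr ≫ t, by ext <;> simp [ht]⟩

/-- If the first map of a short exact sequence is split by `r`, then a short exact sequence
starting at the third term induces one starting at the middle term. -/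
lemma SES.biprod_lift (h : SES f g) (r : Y ⟶ X) (hr : f ≫ r = 𝟙 X) {P Z' : A} {j : Z ⟶ P}
    {q : P ⟶ Z'} (h' : SES j q) :
    SES (biprod.lift r (g ≫ j)) ((biprod.snd : X ⊞ P ⟶ P) ≫ q) := by
  have := h.epi
  have := h'.epi
  have := h'.mono
  have : Mono (biprod.lift r (g ≫ j)) := by
    refine Preadditive.mono_of_cancel_zero _ fun t ht => ?_
    have h1 : t ≫ r = 0 := by simpa using congrArg (· ≫ biprod.fst) ht
    have h2 : t ≫ g ≫ j = 0 := by simpa using congrArg (· ≫ biprod.snd) ht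
    rw [← Category.assoc] at h2
    obtain ⟨t', rfl⟩ := h.exists_lift t (by rwa [← cancel_mono j, zero_comp])
    rw [Category.assoc, hr, Category.comp_id] at h1
    rw [h1, zero_comp]
  refine SES.of_exists_desc (by simp [h'.zero]) fun t ht => ?_
  have h1 : biprod.inl ≫ t = 0 := by
    have := congrArg (f ≫ ·) ht
    have h3 : f ≫ biprod.lift r (g ≫ j) = biprod.inl := by
      ext
      · simp [hr]
      · rw [Category.assoc, biprod.lift_snd, ← Category.assoc, h.zero]; simp
    simpa [← Category.assoc, h3] using this
  have h2 : j ≫ biprod.inr ≫ t = 0 := by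
    rw [← cancel_epi g, comp_zero]
    rw [biprod.lift_eq, Preadditive.add_comp] at ht
    simpa [h1] using ht
  obtain ⟨y, hy⟩ := h'.exists_desc _ h2
  refine ⟨y, ?_⟩
  ext
  · simp [h1]
  · simp [hy]

/-- In a degree where `K` is exact, the cokernel of the incoming differential is a syzygy of the next
such cokernel. -/
lemma ses_opcycles (K : CochainComplex A ℤ) (n n' : ℤ) (hn : n + 1 = n') (h : K.ExactAt n) :
    SES (K.fromOpcycles n n') (K.pOpcycles n') := by
  have : Mono (K.fromOpcycles n n') := by
    refine Preadditive.mono_of_cancel_zero _ fun t ht => ?_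
    obtain ⟨s, hs⟩ := KernelFork.IsLimit.lift' (K.homologyIsKernel n n' (by simp [hn])) t ht
    rw [← hs, (h.isZero_homology).eq_of_tgt s 0, zero_comp]
  refine SES.of_exists_desc (by simp [← cancel_epi (K.pOpcycles n)]) fun t ht => ?_
  have ht' : K.d n n' ≫ t = 0 := by
    rw [← K.p_fromOpcycles, Category.assoc, ht, comp_zero]
  exact ⟨K.descOpcycles t n (by subst hn; simp) ht', by simp⟩

lemma exists_projective_ses [EnoughProjectives A] (X : A) :
    ∃ (P X' : A) (f : X' ⟶ P) (g : P ⟶ X), Projective P ∧ SES f g := by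
  refine ⟨Projective.over X, kernel (Projective.π X), kernel.ι _, Projective.π X, inferInstance,
    by simp, { exact := ShortComplex.exact_kernel _ }⟩

end
end

section
variable {A : Type u} [Category.{v} A] [Abelian A]

/-! ### Gorenstein projective objects -/

/-- There is a short exact sequence `0 ⟶ X ⟶ P ⟶ X' ⟶ 0` with `P` projective such that all
morphisms from `X` to projective objects extend to `P`. -/
def GStep (X X' : A) : Prop :=
  ∃ (P : A) (f : X ⟶ P) (g : P ⟶ X'), Projective P ∧ SES f g ∧ ExtendsToProj f

/-- The third term of a short exact sequence spliced into a complete resolution `K` is Gorenstein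
projective. -/
lemma gproj_of_factorization (K : CochainComplex A ℤ) {X : ℤ → A} (i : ∀ n, X n ⟶ K.X n)
    (p : ∀ n, K.X n ⟶ X (n + 1)) (hS : ∀ n, SES (i n) (p n))
    (hd : ∀ n, K.d n (n + 1) = p n ≫ i (n + 1)) (hP : ∀ n, Projective (K.X n))
    (hE : ∀ n, ExtendsToProj (i n)) : Gproj A (X 1) := by
  refine ⟨K, hP, fun n => ?_, fun Q hQ n f hf => ?_, ⟨?_⟩⟩
  · obtain ⟨m, rfl⟩ : ∃ m, n = m + 1 := ⟨n - 1, by simp⟩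
    rw [HomologicalComplex.exactAt_iff' _ m (m + 1) (m + 1 + 1) (by simp) (by simp)]
    have := (hS m).epi
    have := (hS (m + 1 + 1)).mono
    let S₁ : ShortComplex A := ShortComplex.mk (i (m + 1)) (p (m + 1)) (hS (m + 1)).zero
    let S₂ : ShortComplex A := ShortComplex.mk (i (m + 1)) (p (m + 1) ≫ i (m + 1 + 1))
      (by rw [← Category.assoc, (hS (m + 1)).zero, zero_comp])
    let a : S₁ ⟶ S₂ := { τ₁ := 𝟙 _, τ₂ := 𝟙 _, τ₃ := i (m + 1 + 1) }
    let b : K.sc' m (m + 1) (m + 1 + 1) ⟶ S₂ :=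
      { τ₁ := p m
        τ₂ := 𝟙 _
        τ₃ := 𝟙 _
        comm₁₂ := (hd m).symm.trans (Category.comp_id _).symm
        comm₂₃ := (Category.id_comp _).trans ((hd (m + 1)).symm.trans (Category.comp_id _).symm) }
    have : Epi a.τ₁ := inferInstanceAs (Epi (𝟙 _))
    have : IsIso a.τ₂ := inferInstanceAs (IsIso (𝟙 _))
    have : Mono a.τ₃ := ‹_›
    have : Epi b.τ₁ := ‹_›
    have : IsIso b.τ₂ := inferInstanceAs (IsIso (𝟙 _))
    have : Mono b.τ₃ := inferInstanceAs (Mono (𝟙 _))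
    rw [ShortComplex.exact_iff_of_epi_of_isIso_of_mono b,
      ← ShortComplex.exact_iff_of_epi_of_isIso_of_mono a]
    exact (hS (m + 1)).choose_spec.exact
  · obtain ⟨m, rfl⟩ : ∃ m, n = m + 1 := ⟨n - 1, by simp⟩
    rw [add_sub_cancel_right, hd, Category.assoc] at hf
    have := (hS m).epi
    have h0 : i (m + 1) ≫ f = 0 := by rw [← cancel_epi (p m), hf, comp_zero]
    obtain ⟨f', hf'⟩ := (hS (m + 1)).exists_desc f h0
    obtain ⟨g, hg⟩ := hE (m + 1 + 1) Q hQ f'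
    exact ⟨g, by rw [hd, Category.assoc, hg, hf']⟩
  · let p₁ : K.X (-1) ⟶ X 0 := p (-1)
    let p₀ : K.X 0 ⟶ X 1 := p 0
    have hS₀ : SES (i 0) p₀ := hS 0
    have := hS₀.epi
    have : Epi p₁ := (hS (-1)).epi
    have hd' : K.d (-1) 0 = p₁ ≫ i 0 := hd (-1)
    have hz : K.d (-1) 0 ≫ p₀ = 0 := by rw [hd', Category.assoc, hS₀.zero, comp_zero]
    have hcoker : IsColimit (CokernelCofork.ofπ (f := K.d (-1) 0) p₀ hz) :=
      CokernelCofork.IsColimit.ofπ' _ _ fun {W} t ht => by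
        have h2 : i 0 ≫ t = 0 := by
          rw [← cancel_epi p₁, comp_zero, ← ht, hd', Category.assoc]
        exact ⟨(hS₀.exists_desc t h2).choose, (hS₀.exists_desc t h2).choose_spec⟩
    exact hcoker.coconePointUniqueUpToIso (K.opcyclesIsCokernel (-1) 0 (by simp))

/-- Gorenstein projectivity in terms of two-sided infinite sequences of syzygies, which are spliced
into a complete resolution. -/
lemma gproj_of_gstep_sequence (X : ℤ → A) (h : ∀ n, GStep (X n) (X (n + 1))) :
    Gproj A (X 1) := by
  choose P i p hP hS hE using h
  exact gproj_of_factorization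
    (CochainComplex.of P (fun n => p n ≫ i (n + 1)) (fun n => by
      rw [Category.assoc, ← Category.assoc (i (n + 1)), (hS (n + 1)).zero, zero_comp, comp_zero]))
    i p hS (fun n => by simp [CochainComplex.of]) hP hE

/-- Coinduction principle for Gorenstein projectivity: it suffices that each object of the class is
both the first and the last term of an admissible short exact sequence whose other end is again in
the class. -/
lemma gproj_of_coinduction {W : ObjectProperty A} (hr : ∀ X, W X → ∃ X', GStep X X' ∧ W X')
    (hl : ∀ X, W X → ∃ X', GStep X' X ∧ W X') : W ≤ Gproj A := by
  intro X hX
  choose! r hr hr' using hr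
  choose! l hl hl' using hl
  have hrn (n : ℕ) : W (r^[n] X) := by
    induction n with
    | zero => exact hX
    | succ n ih => rw [Function.iterate_succ_apply']; exact hr' _ ih
  have hln (n : ℕ) : W (l^[n] X) := by
    induction n with
    | zero => exact hX
    | succ n ih => rw [Function.iterate_succ_apply']; exact hl' _ ih
  let Y : ℤ → A := fun
    | .ofNat n => r^[n] X
    | .negSucc n => l^[n + 1] X
  have hY (n : ℤ) : GStep (Y n) (Y (n + 1)) := by
    match n with
    | .ofNat n =>
      change GStep (r^[n] X) (r^[n + 1] X)
      rw [Function.iterate_succ_apply']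
      exact hr _ (hrn n)
    | .negSucc 0 => exact hl X hX
    | .negSucc (n + 1) =>
      change GStep (l^[n + 1 + 1] X) (l^[n + 1] X)
      rw [Function.iterate_succ_apply' (n := n + 1)]
      exact hl _ (hln (n + 1))
  exact gproj_of_gstep_sequence (fun n => Y (n - 1)) (fun n => by
    have := hY (n - 1)
    rwa [show n - 1 + 1 = n + 1 - 1 by ring] at this)

instance : (Gproj A).IsClosedUnderIsomorphisms where
  of_iso := by
    rintro X Y e ⟨P, h₁, h₂, h₃, ⟨e'⟩⟩
    exact ⟨P, h₁, h₂, h₃, ⟨e.symm ≪≫ e'⟩⟩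

lemma SES.of_iso_left {X Y Z X' : A} {f : X ⟶ Y} {g : Y ⟶ Z} (h : SES f g) (e : X' ≅ X) :
    SES (e.hom ≫ f) g := by
  have := h.mono
  have := h.epi
  refine SES.of_exists_desc (by simp [h.zero]) fun t ht => h.exists_desc t ?_
  rwa [Category.assoc, ← cancel_epi e.inv, comp_zero, Iso.inv_hom_id_assoc] at ht

lemma GStep.of_iso_left {X X' Y : A} (h : GStep X Y) (e : X' ≅ X) : GStep X' Y := by
  obtain ⟨P, f, g, hP, hS, hE⟩ := h
  refine ⟨P, _, g, hP, hS.of_iso_left e, fun Q hQ a => ?_⟩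
  obtain ⟨b, hb⟩ := hE Q hQ (e.inv ≫ a)
  exact ⟨b, by rw [Category.assoc, hb, Iso.hom_inv_id_assoc]⟩

lemma GStep.of_iso_right {X X' Y : A} (h : GStep Y X) (e : X ≅ X') : GStep Y X' := by
  obtain ⟨P, f, g, hP, hS, hE⟩ := h
  have := hS.mono
  have := hS.epi
  refine ⟨P, f, g ≫ e.hom, hP, SES.of_exists_desc (by simp [reassoc_of% hS.zero])
    fun t ht => ?_, hE⟩
  obtain ⟨y, hy⟩ := hS.exists_desc t ht
  exact ⟨e.inv ≫ y, by simp [hy]⟩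

/-- Conversely to the coinduction principle, a Gorenstein projective object is a syzygy and a
cosyzygy of such objects. -/
lemma gproj_steps {X : A} (hX : Gproj A X) :
    (∃ X', GStep X X' ∧ Gproj A X') ∧ (∃ X', GStep X' X ∧ Gproj A X') := by
  obtain ⟨P, hP, hex, hE, ⟨e⟩⟩ := hX
  have step (n n' : ℤ) (hn : n + 1 = n') : GStep (P.opcycles n) (P.opcycles n') := by
    have hS := ses_opcycles P n n' hn (hex n)
    refine ⟨P.X n', _, _, hP n', hS, fun Q hQ a => ?_⟩
    subst hn
    obtain ⟨b, hb⟩ := hE Q hQ n (P.pOpcycles n ≫ a) (by simp)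
    exact ⟨b, by simp [← cancel_epi (P.pOpcycles n), hb]⟩
  have hW (n : ℤ) : Gproj A (P.opcycles n) := by
    refine gproj_of_coinduction (W := fun X => ∃ n, X = P.opcycles n) ?_ ?_ _ ⟨n, rfl⟩
    · rintro _ ⟨n, rfl⟩
      exact ⟨_, step n _ rfl, _, rfl⟩
    · rintro _ ⟨n, rfl⟩
      exact ⟨_, step (n - 1) n (by simp), _, rfl⟩
  exact ⟨⟨_, (step 0 1 (by simp)).of_iso_left e, hW 1⟩,
    ⟨_, (step (-1) 0 (by simp)).of_iso_right e.symm, hW (-1)⟩⟩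

/-! ### Finite resolutions -/

/-- The objects with a finite resolution by objects of `X` in which all terms, except possibly
the last one, are projective. -/
inductive FinDim (X : ObjectProperty A) : A → Prop
  | of_mem {C : A} (hC : X C) : FinDim X C
  | cosyzygy {C P C' : A} (f : C' ⟶ P) (g : P ⟶ C) (hP : Projective P) (h : SES f g)
      (hC' : FinDim X C') : FinDim X C

lemma finDim_projective_syzygy {N : A} (hN : FinDim (isProjective A) N) :
    ∃ (N' P : A) (i : N' ⟶ P) (p : P ⟶ N), Projective P ∧ SES i p ∧
      FinDim (isProjective A) N' := by
  cases hN with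
  | of_mem hC =>
    exact ⟨0, N, 0, 𝟙 N, hC, SES.of_exists_desc zero_comp fun t _ => ⟨t, by simp⟩,
      .of_mem (inferInstanceAs (Projective (0 : A)))⟩
  | cosyzygy f g hP h hC' => exact ⟨_, _, f, g, hP, h, hC'⟩

end

/-! ### Closure properties of Gorenstein projective objects -/

section
variable {A : Type u} [Category.{v} A] [Abelian A] [HasDerivedCategory.{w} A]

/-- There are no higher extensions from `X` to projective objects. -/
def Perp (X : A) : Prop := ∀ Q : A, Projective Q → ∀ n : ℤ, 1 ≤ n → ExtVanish X Q n

lemma perp_of_projective (X : A) [Projective X] : Perp X :=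
  fun _ _ _ hn => extVanish_of_projective _ _ hn

lemma Perp.of_retract {X Y : A} (h : Perp Y) (r : Retract X Y) : Perp X := by
  intro Q hQ n hn φ
  have h1 : (singleFunctor A 0).map r.i ≫ (singleFunctor A 0).map r.r = 𝟙 _ := by
    rw [← Functor.map_comp, r.retract, CategoryTheory.Functor.map_id]
  have h2 : (singleFunctor A 0).map r.r ≫ φ = 0 := h Q hQ n hn _
  rw [← Category.id_comp φ, ← h1, Category.assoc, h2, comp_zero]

section
variable {X Y Z : A} {f : X ⟶ Y} {g : Y ⟶ Z}

lemma SES.perp₁ (h : SES f g) (hY : Perp Y) (hZ : Perp Z) : Perp X :=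
  fun Q hQ n hn => h.extVanish₁ (hY Q hQ n hn) (hZ Q hQ _ (by lia))

lemma SES.perp₂ (h : SES f g) (hX : Perp X) (hZ : Perp Z) : Perp Y :=
  fun Q hQ n hn => h.extVanish₂ (hX Q hQ n hn) (hZ Q hQ n hn)

lemma SES.extendsToProj_of_perp (h : SES f g) (hZ : Perp Z) : ExtendsToProj f :=
  h.extendsToProj fun Q hQ => hZ Q hQ 1 le_rfl

end

/-- The extensions of `X` are those of lower degree of its syzygies; and in degree `1` they vanish
as morphisms to projective objects extend along the inclusion of the first syzygy. -/
lemma perp_of_gproj {X : A} (hX : Gproj A X) : Perp X := by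
  have key (n : ℕ) : ∀ X : A, Gproj A X → ∀ Q : A, Projective Q → ExtVanish X Q (n + 1 : ℤ) := by
    induction n with
    | zero =>
      intro X hX Q hQ
      obtain ⟨-, X', ⟨P, f, g, hP, hS, hE⟩, -⟩ := gproj_steps hX
      exact hS.extVanish_one hQ hE (extVanish_of_projective _ _ le_rfl)
    | succ n ih =>
      intro X hX Q hQ
      obtain ⟨-, X', ⟨P, f, g, hP, hS, hE⟩, hX'⟩ := gproj_steps hX
      push_cast
      exact hS.extVanish₃ (extVanish_of_projective _ _ (by lia)) (ih X' hX' Q hQ)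
  intro Q hQ n hn
  obtain ⟨m, rfl⟩ : ∃ m : ℕ, n = m + 1 := ⟨(n - 1).toNat, by lia⟩
  exact key m X hX Q hQ

lemma extVanish_of_finDim {G L : A} (hG : Gproj A G) (hL : FinDim (isProjective A) L) {n : ℤ}
    (hn : 1 ≤ n) : ExtVanish G L n := by
  induction hL generalizing n with
  | of_mem hC => exact perp_of_gproj hG _ hC n hn
  | cosyzygy f g hP h hC' ih =>
    exact h.extVanish_target₃ (perp_of_gproj hG _ hP n hn) (ih (by lia))

variable [EnoughProjectives A]

/-- The iterated syzygies of the objects of `W`. -/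
inductive SyzygyClosure (W : ObjectProperty A) : A → Prop
  | of_mem {X : A} (hX : W X) : SyzygyClosure W X
  | syzygy {X P X' : A} (f : X' ⟶ P) (g : P ⟶ X) (hP : Projective P) (h : SES f g)
      (hX : SyzygyClosure W X) : SyzygyClosure W X'

/-- One-sided coinduction principle for Gorenstein projectivity: as there are enough projectives,
only cosyzygies within the class have to be provided. -/
lemma gproj_of_perp {W : ObjectProperty A} (hW : ∀ X, W X → Perp X)
    (hr : ∀ X, W X → ∃ (P X' : A) (f : X ⟶ P) (g : P ⟶ X'), Projective P ∧ SES f g ∧ W X') :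
    W ≤ Gproj A := by
  have hW' (X : A) (hX : SyzygyClosure W X) : Perp X := by
    induction hX with
    | of_mem hX => exact hW _ hX
    | syzygy f g hP h hX ih => exact h.perp₁ (perp_of_projective _) ih
  intro X hX
  refine gproj_of_coinduction (W := SyzygyClosure W) (fun X hX => ?_) (fun X hX => ?_) X
    (.of_mem hX)
  · cases hX with
    | of_mem hX =>
      obtain ⟨P, X', f, g, hP, hS, hX'⟩ := hr X hX
      exact ⟨X', ⟨P, f, g, hP, hS, hS.extendsToProj_of_perp (hW X' hX')⟩, .of_mem hX'⟩
    | syzygy f g hP h hX => exact ⟨_, ⟨_, f, g, hP, h, h.extendsToProj_of_perp (hW' _ hX)⟩, hX⟩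
  · obtain ⟨P, X', f, g, hP, hS⟩ := exists_projective_ses X
    exact ⟨X', ⟨P, f, g, hP, hS, hS.extendsToProj_of_perp (hW' _ hX)⟩, .syzygy f g hP hS hX⟩

lemma gproj_of_projective (X : A) [hX : Projective X] : Gproj A X := by
  refine gproj_of_perp (W := isProjective A) (fun X hX => ?_) (fun X hX => ?_) X hX
  · have : Projective X := hX
    exact perp_of_projective X
  · exact ⟨X, 0, 𝟙 X, 0, hX, SES.of_exists_desc comp_zero fun t ht => ⟨0, by simpa using ht.symm⟩,
      inferInstanceAs (Projective (0 : A))⟩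

section
variable {X Y Z : A} {f : X ⟶ Y} {g : Y ⟶ Z}

/-- The pushout of the extension along an embedding of its first term into a projective object is a
split extension, which yields an embedding of `Y` into a projective object. -/
lemma SES.gproj₂ (h : SES f g) (hX : Gproj A X) (hZ : Gproj A Z) : Gproj A Y := by
  refine gproj_of_perp (W := fun Y => ∃ (X Z : A) (f : X ⟶ Y) (g : Y ⟶ Z), SES f g ∧
    Gproj A X ∧ Gproj A Z) ?_ ?_ Y ⟨X, Z, f, g, h, hX, hZ⟩
  · rintro Y ⟨X, Z, f, g, h, hX, hZ⟩
    exact h.perp₂ (perp_of_gproj hX) (perp_of_gproj hZ)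
  · rintro Y ⟨X, Z, f, g, h, hX, hZ⟩
    obtain ⟨⟨X', ⟨P, j, q, hP, hj, -⟩, hX'⟩, -⟩ := gproj_steps hX
    obtain ⟨⟨Z', ⟨P', j', q', hP', hj', -⟩, hZ'⟩, -⟩ := gproj_steps hZ
    obtain ⟨W, a, c, b, d, hac, hbd⟩ := h.exists_pushout hj
    obtain ⟨r, hr⟩ := hac.extendsToProj_of_perp (perp_of_gproj hZ) P hP (𝟙 P)
    obtain ⟨W', r', s, t, hr', hst⟩ := hbd.exists_comp (hac.biprod_lift r hr hj')
    exact ⟨_, W', _, r', inferInstance, hr', X', Z', s, t, hst, hX', hZ'⟩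

/-- A cosyzygy of `X` is obtained from a cosyzygy `G` of `X ⊞ Y`: it is the cokernel `W` of the
composite of `X ⟶ X ⊞ Y ⟶ P`, and `W ⊞ X` is an extension of `G` by `Y ⊞ X`. -/
lemma gproj_of_biprod {X Y : A} (h : Gproj A (X ⊞ Y)) : Gproj A X := by
  refine gproj_of_perp (W := fun X => ∃ Y, Gproj A (X ⊞ Y)) ?_ ?_ X ⟨Y, h⟩
  · rintro X ⟨Y, h⟩
    exact (perp_of_gproj h).of_retract ⟨biprod.inl, biprod.fst, by simp⟩
  · rintro X ⟨Y, h⟩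
    obtain ⟨⟨G, ⟨P, j, q, hP, hj, -⟩, hG⟩, -⟩ := gproj_steps h
    obtain ⟨W, r, s, t, hr, hst⟩ := (SES.of_biprod X Y).exists_comp hj
    exact ⟨P, W, _, r, hP, hr, X, (hst.biprod_map_id X).gproj₂
      ((Gproj A).prop_of_iso (biprod.braiding X Y) h) hG⟩

instance : (Gproj A).IsStableUnderRetracts where
  of_retract {X Y} r hY := by
    have := r.instIsSplitEpiR
    let S : ShortComplex A := ShortComplex.mk (kernel.ι r.r) r.r (by simp)
    have hS : S.Exact := ShortComplex.exact_kernel _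
    let σ : S.Splitting := ShortComplex.Splitting.ofExactOfSection S hS r.i r.retract inferInstance
    exact gproj_of_biprod ((Gproj A).prop_of_iso
      (σ.isoBinaryBiproduct ≪≫ biprod.braiding _ _) hY)

lemma SES.gproj₁ (h : SES f g) [hY : Projective Y] (hZ : Gproj A Z) : Gproj A X := by
  refine gproj_of_perp (W := fun X => Gproj A X ∨ ∃ (P Z : A) (f : X ⟶ P) (g : P ⟶ Z),
    Projective P ∧ SES f g ∧ Gproj A Z) ?_ ?_ X (Or.inr ⟨Y, Z, f, g, hY, h, hZ⟩)
  · rintro X (hX | ⟨P, Z, f, g, hP, h, hZ⟩)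
    · exact perp_of_gproj hX
    · exact h.perp₁ (perp_of_projective _) (perp_of_gproj hZ)
  · rintro X (hX | ⟨P, Z, f, g, hP, h, hZ⟩)
    · obtain ⟨⟨G, ⟨P, j, q, hP, hj, -⟩, hG⟩, -⟩ := gproj_steps hX
      exact ⟨P, G, j, q, hP, hj, Or.inl hG⟩
    · exact ⟨P, Z, f, g, hP, h, Or.inl hZ⟩

/-- Any cosyzygy of a Gorenstein projective object is Gorenstein projective, provided that morphisms
to projective objects extend along its inclusion: by pushout, it is a direct summand of an extension
of Gorenstein projective objects. -/
lemma SES.gproj₃ (h : SES f g) [hY : Projective Y] (hf : ExtendsToProj f) (hX : Gproj A X) :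
    Gproj A Z := by
  obtain ⟨⟨G, ⟨P, j, q, hP, hj, -⟩, hG⟩, -⟩ := gproj_steps hX
  obtain ⟨W, a, c, b, d, hac, hbd⟩ := h.exists_pushout hj
  obtain ⟨r, hr⟩ := hac.extendsToProj
    (fun Q hQ => h.extVanish_one hQ hf (extVanish_of_projective _ _ le_rfl)) P hP (𝟙 P)
  obtain ⟨r'⟩ := hac.nonempty_retract r hr
  exact (Gproj A).prop_of_retract r' (hbd.gproj₂ (gproj_of_projective Y) hG)

end

/-! ### Objects of finite Gorenstein projective dimension -/

/-- Objects of finite Gorenstein projective dimension embed into objects of finite projective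
dimension, with a Gorenstein projective cokernel. -/
lemma exists_approximation {C : A} (hC : FinDim (Gproj A) C) :
    ∃ (L G : A) (f : C ⟶ L) (g : L ⟶ G), SES f g ∧ FinDim (isProjective A) L ∧ Gproj A G := by
  induction hC with
  | of_mem hC =>
    obtain ⟨⟨G, ⟨P, j, q, hP, hj, -⟩, hG⟩, -⟩ := gproj_steps hC
    exact ⟨P, G, j, q, hj, .of_mem hP, hG⟩
  | @cosyzygy C P C' f g hP h hC' ih =>
    obtain ⟨L, G, i, p, hip, hL, hG⟩ := ih
    obtain ⟨W, a, c, b, d, hac, hbd⟩ := h.exists_pushout hip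
    obtain ⟨⟨G', ⟨P', j, q, hP', hj, -⟩, hG'⟩, -⟩ :=
      gproj_steps (hbd.gproj₂ (gproj_of_projective P) hG)
    obtain ⟨L', r, s, t, hr, hst⟩ := hac.exists_comp hj
    exact ⟨L', G', s, t, hst, .cosyzygy _ r hP' hr hL, hG'⟩

end

/-! ### Cokernels in projective resolutions -/

section
variable {A : Type u} [Category.{v} A] [Abelian A]

open CochainComplex HomComplex in
/-- The cokernels in the mapping cone are extensions of those in `K` by those in `L`. Exactness of
`L` is needed for the injectivity on the left. -/
lemma ses_opcycles_mappingCone {K L : CochainComplex A ℤ} (φ : K ⟶ L) (j : ℤ)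
    (hL : L.ExactAt j) :
    ∃ g : (mappingCone φ).opcycles j ⟶ K.opcycles (j + 1),
      SES (HomologicalComplex.opcyclesMap (mappingCone.inr φ) j) g := by
  have hz : (mappingCone φ).d (j - 1) j ≫ (mappingCone.fst φ).1.v j (j + 1) rfl ≫
      K.pOpcycles (j + 1) = 0 := by
    rw [mappingCone.d_fst_v_assoc φ (j - 1) j (j + 1) (by lia) rfl]
    simp
  let g : (mappingCone φ).opcycles j ⟶ K.opcycles (j + 1) :=
    (mappingCone φ).descOpcycles ((mappingCone.fst φ).1.v j (j + 1) rfl ≫ K.pOpcycles (j + 1))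
      (j - 1) (by simp) hz
  have hg : (mappingCone φ).pOpcycles j ≫ g =
      (mappingCone.fst φ).1.v j (j + 1) rfl ≫ K.pOpcycles (j + 1) := by simp [g]
  have h1 : (mappingCone.inl φ).v (j + 1) j (by lia) ≫ (mappingCone φ).pOpcycles j ≫ g =
      K.pOpcycles (j + 1) := by
    rw [hg, mappingCone.inl_v_fst_v_assoc]
  have : Epi g := epi_of_epi_fac ((Category.assoc _ _ _).trans h1)
  have : Mono (HomologicalComplex.opcyclesMap (mappingCone.inr φ) j) := by
    have := (ses_opcycles L j (j + 1) rfl hL).mono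
    have : Mono ((mappingCone.inr φ).f (j + 1)) :=
      mono_of_mono_fac (mappingCone.inr_f_snd_v φ (j + 1))
    have h : HomologicalComplex.opcyclesMap (mappingCone.inr φ) j ≫
        (mappingCone φ).fromOpcycles j (j + 1) =
        L.fromOpcycles j (j + 1) ≫ (mappingCone.inr φ).f (j + 1) := by
      simp [← cancel_epi (L.pOpcycles j)]
    exact mono_of_mono_fac h
  refine ⟨g, SES.of_exists_desc ?_ fun t ht => ?_⟩
  · rw [← cancel_epi (L.pOpcycles j), HomologicalComplex.p_opcyclesMap_assoc, hg,
      mappingCone.inr_f_fst_v_assoc]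
    simp
  · have h2 : (mappingCone.inr φ).f j ≫ (mappingCone φ).pOpcycles j ≫ t = 0 := by
      rw [← HomologicalComplex.p_opcyclesMap_assoc, ht, comp_zero]
    have h3 : K.d j (j + 1) ≫ (mappingCone.inl φ).v (j + 1) j (by lia) ≫
        (mappingCone φ).pOpcycles j ≫ t = 0 := by
      have h4 := mappingCone.inl_v_d φ j (j - 1) (j + 1) (by lia) (by lia)
      have h5 := congrArg (· ≫ (mappingCone φ).pOpcycles j ≫ t) h4
      simpa [h2] using h5.symm
    refine ⟨K.descOpcycles _ j (by simp) h3, ?_⟩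
    rw [← cancel_epi ((mappingCone φ).pOpcycles j), ← Category.assoc, hg, Category.assoc,
      HomologicalComplex.p_descOpcycles]
    refine mappingCone.ext_from φ _ _ (by lia : j + 1 = j + 1) ?_ ?_
    · simp
    · simp [h2]

/-- The cokernels in a shift of `K` are those in `K`, with the degree shifted; the signs in the
differentials of the shift do not matter. -/
noncomputable def opcyclesShiftIso (K : CochainComplex A ℤ) (a j j' : ℤ) (h : a + j = j') :
    (K⟦a⟧).opcycles j ≅ K.opcycles j' :=
  ShortComplex.opcyclesMapIso ((CochainComplex.shiftShortComplexFunctorIso A a j j' h).app K)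

/-- A homotopy retract of complexes induces a retract of cokernels up to a term of the complex. -/
lemma nonempty_retract_opcycles {P K : CochainComplex A ℤ} (a : P ⟶ K) (b : K ⟶ P)
    (h : Homotopy (a ≫ b) (𝟙 P)) (j : ℤ) :
    Nonempty (Retract (P.opcycles j) (K.opcycles j ⊞ P.X (j + 1))) := by
  refine ⟨⟨biprod.lift (HomologicalComplex.opcyclesMap a j) (P.fromOpcycles j (j + 1)),
    biprod.desc (HomologicalComplex.opcyclesMap b j) (-(h.hom (j + 1) j ≫ P.pOpcycles j)), ?_⟩⟩
  have hj := h.comm j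
  rw [dNext_eq h.hom (show (ComplexShape.up ℤ).Rel j (j + 1) by simp),
    prevD_eq h.hom (show (ComplexShape.up ℤ).Rel (j - 1) j by simp)] at hj
  have hj' := congrArg (· ≫ P.pOpcycles j) hj
  simp at hj'
  simp [← cancel_epi (P.pOpcycles j), hj']

variable [HasDerivedCategory.{w} A]

lemma exactAt_of_isGE (K : CochainComplex A ℤ) (i j : ℤ) (h : (Q.obj K).IsGE i) (hj : j < i) :
    K.ExactAt j := by
  rw [isGE_Q_obj_iff] at h
  exact K.exactAt_of_isGE i j hj

lemma IsProjResolution.exactAt {K : CochainComplex A ℤ} {s : ℤ} {M : DerivedCategory A}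
    (hK : IsProjResolution K s M) (i : ℤ) [hM : M.IsGE i] (j : ℤ) (hj : j < i) :
    K.ExactAt j :=
  exactAt_of_isGE K i j (TStructure.t.isGE_of_iso hK.nonempty_iso.some.symm i) hj

lemma IsProjResolution.isLE {K : CochainComplex A ℤ} {s : ℤ} {M : DerivedCategory A}
    (hK : IsProjResolution K s M) : M.IsLE s := by
  have := hK.isStrictlyLE
  exact TStructure.t.isLE_of_iso hK.nonempty_iso.some s

lemma isZero_of_retract {C : Type u'} [Category.{v'} C] [HasZeroMorphisms C] {X Y : C}
    (r : Retract X Y) (h : IsZero Y) : IsZero X := by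
  rw [IsZero.iff_id_eq_zero, ← r.retract, h.eq_of_tgt r.i 0, zero_comp]

lemma isGE_of_retract {X Y : DerivedCategory A} (r : Retract X Y) (n : ℤ) [hY : Y.IsGE n] :
    X.IsGE n := by
  rw [isGE_iff] at hY ⊢
  exact fun i hi => isZero_of_retract (r.map (homologyFunctor A i)) (hY i hi)

lemma isLE_of_retract {X Y : DerivedCategory A} (r : Retract X Y) (n : ℤ) [hY : Y.IsLE n] :
    X.IsLE n := by
  rw [isLE_iff] at hY ⊢
  exact fun i hi => isZero_of_retract (r.map (homologyFunctor A i)) (hY i hi)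

lemma IsProjResolution.nonempty_retract {P K : CochainComplex A ℤ} {s s' : ℤ}
    {M N : DerivedCategory A} (hP : IsProjResolution P s M) (hK : IsProjResolution K s' N)
    (r : Retract M N) (j : ℤ) :
    Nonempty (Retract (P.opcycles j) (K.opcycles j ⊞ P.X (j + 1))) := by
  have := hP.isKProjective
  have := hK.isKProjective
  obtain ⟨e⟩ := hP.nonempty_iso
  obtain ⟨e'⟩ := hK.nonempty_iso
  obtain ⟨a, ha⟩ := exists_Q_map_eq P K (e.hom ≫ r.i ≫ e'.inv)
  obtain ⟨b, hb⟩ := exists_Q_map_eq K P (e'.hom ≫ r.r ≫ e.inv)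
  obtain ⟨h⟩ := homotopy_of_Q_map_eq (a ≫ b) (𝟙 P) (by
    rw [CategoryTheory.Functor.map_comp, ha, hb, CategoryTheory.Functor.map_id]
    simp [r.retract_assoc])
  exact nonempty_retract_opcycles a b h j

/-! ### Complexes of finite Gorenstein projective dimension -/

/-- The objects with bounded below cohomology and with a bounded above projective resolution in which
the cokernels `K.opcycles j` of the differentials ending in small degrees `j` are Gorenstein
projective. -/
def GFinite (A : Type u) [Category.{v} A] [Abelian A] [HasDerivedCategory.{w} A] :
    ObjectProperty (DerivedCategory A) := fun E =>
  (∃ a : ℤ, E.IsGE a) ∧ ∃ (K : CochainComplex A ℤ) (s : ℤ), IsProjResolution K s E ∧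
    ∃ m : ℤ, ∀ j ≤ m, Gproj A (K.opcycles j)

variable [EnoughProjectives A]

/-- The condition in the definition of `GFinite` does not depend on the projective resolution, and it
passes to direct summands. -/
lemma GFinite.of_retract {M N : DerivedCategory A} (r : Retract M N) (hN : GFinite A N)
    {P : CochainComplex A ℤ} {s : ℤ} (hP : IsProjResolution P s M) :
    ∃ m : ℤ, ∀ j ≤ m, Gproj A (P.opcycles j) := by
  obtain ⟨-, K, s', hK, m, hm⟩ := hN
  refine ⟨m, fun j hj => ?_⟩
  obtain ⟨r'⟩ := hP.nonempty_retract hK r j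
  have := hP.projective (j + 1)
  exact (Gproj A).prop_of_retract r'
    ((SES.of_biprod _ _).gproj₂ (hm j hj) (gproj_of_projective _))

instance : (GFinite A).IsStableUnderRetracts where
  of_retract {M N} r hN := by
    obtain ⟨⟨a, ha⟩, K, s, hK, hm⟩ := id hN
    have := isGE_of_retract r a
    have := hK.isLE
    have := isLE_of_retract r s
    have : M.IsLE (max s a) := TStructure.t.isLE_of_le M s _ (by lia)
    obtain ⟨P, hP⟩ := exists_projResolution a (max s a + 1 - a).toNat (max s a) (by lia) M
    exact ⟨⟨a, ‹_›⟩, P, _, hP, hN.of_retract r hP⟩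

instance : (GFinite A).IsClosedUnderIsomorphisms where
  of_iso e h := (GFinite A).prop_of_retract e.symm.retract h

instance : (GFinite A).IsStableUnderShift ℤ where
  isStableUnderShiftBy a := ⟨by
    rintro M ⟨⟨i, hi⟩, K, s, hK, m, hm⟩
    refine ⟨⟨i - a, TStructure.t.isGE_shift M i a (i - a) (by lia)⟩, K⟦a⟧, s - a,
      hK.shift a _ (by lia), m - a, fun j hj => ?_⟩
    exact (Gproj A).prop_of_iso (opcyclesShiftIso K a j _ rfl).symm (hm _ (by lia))⟩

instance : (GFinite A).IsTriangulatedClosed₃ := .mk' fun T hT h₁ h₂ => by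
  obtain ⟨⟨i, hi⟩, K, s, hK, m, hm⟩ := h₁
  obtain ⟨⟨i', hi'⟩, K', s', hK', m', hm'⟩ := h₂
  have := TStructure.t.isGE_shift T.obj₁ i 1 (i - 1) (by lia)
  have := TStructure.t.isGE_of_ge (T.obj₁⟦(1 : ℤ)⟧) (min (i - 1) i') (i - 1) (by lia)
  have := TStructure.t.isGE_of_ge T.obj₂ (min (i - 1) i') i' (by lia)
  refine ⟨⟨min (i - 1) i', TStructure.t.isGE₂ _ (rot_of_distTriang _ hT) _ ‹_› ‹_›⟩, ?_⟩
  obtain ⟨φ, hφ⟩ := IsProjResolution.exists_mappingCone hT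
    (hK.mono (by lia : s ≤ max s s' + 1)) (hK'.mono (by lia : s' ≤ max s s'))
  refine ⟨_, _, hφ, min (min (m - 1) m') (i' - 1), fun j hj => ?_⟩
  obtain ⟨g, hg⟩ := ses_opcycles_mappingCone φ j (hK'.exactAt i' j (by lia))
  exact hg.gproj₂ (hm' j (by lia)) (hm (j + 1) (by lia))

lemma gFinite_single {G : A} (hG : Gproj A G) : GFinite A ((singleFunctor A 0).obj G) := by
  obtain ⟨K, hK⟩ := exists_projResolution_single G
  refine ⟨⟨0, inferInstance⟩, K, 0, hK, 0, fun j hj => ?_⟩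
  have h0 : Gproj A (K.opcycles 0) := by
    obtain ⟨e⟩ := hK.nonempty_iso
    have := hK.isStrictlyLE
    exact (Gproj A).prop_of_iso ((singleFunctorCompHomologyFunctorIso A 0).symm.app G ≪≫
      (homologyFunctor A 0).mapIso e.symm ≪≫ (homologyFunctorFactors A 0).app K ≪≫
      K.isoHomologyι 0 1 (by simp) ((K.isZero_of_isStrictlyLE 0 1 (by lia)).eq_of_tgt _ _)) hG
  induction j, hj using Int.leInductionDown with
  | base => exact h0
  | pred j hj ih =>
    have := hK.projective j
    exact (ses_opcycles K (j - 1) j (by lia) (hK.exactAt 0 _ (by lia))).gproj₁ ih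

instance : (GFinite A).ContainsZero :=
  ⟨_, (singleFunctor A 0).map_isZero (isZero_zero A), gFinite_single (gproj_of_projective _)⟩

instance : (GFinite A).IsTriangulated where
  toIsTriangulatedClosed₂ := .of_isTriangulatedClosed₃

instance : ((GFinite A).inverseImage (Bounded.ι (C := A))).IsStableUnderRetracts where
  of_retract r h := (GFinite A).prop_of_retract (r.map Bounded.ι) h

/-- The objects of finite level with respect to Gorenstein projective objects have finite Gorenstein
projective dimension, since the latter property defines a thick subcategory. -/
lemma gFinite_of_thickening {X : ObjectProperty A} (hX : X ≤ Gproj A) (n : ℕ) (M : Bounded A)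
    (hM : thickening (inDb X) n M) : GFinite A M.obj := by
  refine thickening_le (Z := (GFinite A).inverseImage Bounded.ι) ?_ n M hM
  rintro N ⟨B, hB, ⟨e⟩⟩
  exact (GFinite A).prop_of_iso e.symm (gFinite_single (hX _ hB))

end

/-! ### Vanishing of morphisms and the terms of the truncated resolution -/

section
variable {A : Type u} [Category.{v} A] [Abelian A] [HasDerivedCategory.{w} A]

/-- Morphisms to a shift of `W` extend along `f` if the extensions of `Z` by `W` in the next degree
vanish. -/
lemma SES.exists_extension {X Y Z : A} {f : X ⟶ Y} {g : Y ⟶ Z} (h : SES f g) {W : A} (a b : ℤ)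
    (hZ : ExtVanish Z W (b - a + 1))
    (φ : ((singleFunctor A 0).obj X)⟦a⟧ ⟶ ((singleFunctor A 0).obj W)⟦b⟧) :
    ∃ ψ : ((singleFunctor A 0).obj Y)⟦a⟧ ⟶ ((singleFunctor A 0).obj W)⟦b⟧,
      φ = ((singleFunctor A 0).map f)⟦a⟧' ≫ ψ := by
  obtain ⟨δ, hT⟩ := h.exists_triangle
  refine exists_shift_factor₂ (inv_rot_of_distTriang _ hT) a φ ?_
  have key (χ : ((singleFunctor A 0).obj Z)⟦(-1 : ℤ)⟧⟦a⟧ ⟶ ((singleFunctor A 0).obj W)⟦b⟧) :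
      χ = 0 := by
    rw [← cancel_epi ((shiftFunctorAdd (DerivedCategory A) (-1) a).hom.app _), comp_zero]
    exact hZ.eq_zero _ _ (by lia) _
  exact key _

/-- A morphism from the cokernel in degree `j` to `Z` defines a chain map from `K` to `Z` placed in
degree `j`; a null-homotopy of it extends the morphism to the next term of `K`. -/
lemma IsProjResolution.exists_desc {K : CochainComplex A ℤ} {s : ℤ} {M : DerivedCategory A}
    (hK : IsProjResolution K s M) (j : ℤ) {Z : A}
    (h : ∀ f : M ⟶ ((singleFunctor A 0).obj Z)⟦-j⟧, f = 0) (α : K.opcycles j ⟶ Z) :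
    ∃ β : K.X (j + 1) ⟶ Z, K.fromOpcycles j (j + 1) ≫ β = α := by
  have := hK.isKProjective
  obtain ⟨e⟩ := hK.nonempty_iso
  let p : K ⟶ (HomologicalComplex.single A (ComplexShape.up ℤ) j).obj Z :=
    HomologicalComplex.mkHomToSingle (K.pOpcycles j ≫ α) (fun i hi => by simp)
  let q : Q.obj K ⟶ (singleFunctor A j).obj Z := Q.map p
  let u := singleShiftIso j (-j) (by simp) Z
  have hq : q = 0 := by
    have := h (e.inv ≫ q ≫ u.inv)
    rw [← cancel_mono u.inv, ← cancel_epi e.inv, this]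
    simp
  obtain ⟨t⟩ := homotopy_of_Q_map_eq p 0 (by rw [Functor.map_zero]; exact hq)
  have ht := t.comm j
  rw [dNext_eq t.hom (show (ComplexShape.up ℤ).Rel j (j + 1) by simp),
    prevD_eq t.hom (show (ComplexShape.up ℤ).Rel (j - 1) j by simp),
    HomologicalComplex.mkHomToSingle_f] at ht
  refine ⟨t.hom (j + 1) j ≫ (HomologicalComplex.singleObjXSelf (ComplexShape.up ℤ) j Z).hom, ?_⟩
  rw [← cancel_epi (K.pOpcycles j), HomologicalComplex.p_fromOpcycles_assoc, ← Category.assoc,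
    ← cancel_mono (HomologicalComplex.singleObjXSelf (ComplexShape.up ℤ) j Z).inv, ht]
  simp

variable [EnoughProjectives A]

section
variable {K : CochainComplex A ℤ} {s : ℤ} {M : Bounded A} (hK : IsProjResolution K s M.obj)
  (i : ℤ) [hi : M.obj.IsGE i] (n : ℕ)
include hK

/-- Such a morphism factors through an object placed in degree `i - 1`, hence is zero by the ghost
lemma. -/
lemma hom_eq_zero_of_thickening_projective (hM : thickening (inDb (isProjective A)) (n + 1) M)
    (Z : A) (m : ℤ) (hm : n + 1 - i ≤ m) (f : M.obj ⟶ ((singleFunctor A 0).obj Z)⟦m⟧) :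
    f = 0 := by
  have := hK.isStrictlyLE
  have := hK.projective
  obtain ⟨e⟩ := hK.nonempty_iso
  have : K.IsGE (i - 1) := by
    rw [← isGE_Q_obj_iff]
    have := TStructure.t.isGE_of_ge M.obj (i - 1) i
    exact TStructure.t.isGE_of_iso e.symm _
  have hf := exists_factor_single K s (i - 1) e m (by lia) Z f
  rw [neg_sub] at hf
  obtain ⟨a, b, rfl⟩ := hf
  refine comp_eq_zero_of_thickening (X := isProjective A) (Y := ⊤) (fun B N hB _ k hk => ?_)
    (fun N _ => ?_) n M hM i trivial a hm b
  · have : Projective B := hB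
    exact extVanish_of_projective _ _ hk
  · obtain ⟨P, N', j, p, hP, hS⟩ := exists_projective_ses N
    exact ⟨N', P, j, p, hP, hS, trivial⟩

/-- The inclusion of the preceding cokernel into `K` splits. -/
lemma projective_opcycles (hM : thickening (inDb (isProjective A)) (n + 1) M) :
    Projective (K.opcycles (i - n)) := by
  obtain ⟨j, hj⟩ : ∃ j, i - n = j + 1 := ⟨i - n - 1, by simp⟩
  rw [hj]
  obtain ⟨r, hr⟩ := hK.exists_desc j
    (fun f => hom_eq_zero_of_thickening_projective hK i n hM _ _ (by lia) f) (𝟙 (K.opcycles j))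
  obtain ⟨r'⟩ := (ses_opcycles K j (j + 1) rfl (hK.exactAt i j (by lia))).nonempty_retract r hr
  have := hK.projective (j + 1)
  exact r'.projective

variable {X : ObjectProperty A} (hX : X ≤ Gproj A)
include hX

/-- Such a morphism factors through the cokernel in degree `i - 1`, which has finite Gorenstein
projective dimension and is replaced by an object of finite projective dimension in order to apply
the ghost lemma. -/
lemma hom_eq_zero_of_thickening_gproj (hM : thickening (inDb X) (n + 1) M) {Z : A}
    (hZ : Projective Z) (m : ℤ) (hm : n + 1 - i ≤ m)
    (f : M.obj ⟶ ((singleFunctor A 0).obj Z)⟦m⟧) : f = 0 := by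
  have := hK.isStrictlyLE
  have hP := hK.projective
  obtain ⟨e⟩ := hK.nonempty_iso
  have : K.IsGE (i - 1) := by
    rw [← isGE_Q_obj_iff]
    have := TStructure.t.isGE_of_ge M.obj (i - 1) i
    exact TStructure.t.isGE_of_iso e.symm _
  have hf := exists_factor_single K s (i - 1) e m (by lia) Z f
  rw [neg_sub] at hf
  obtain ⟨a, b, rfl⟩ := hf
  obtain ⟨k, hk⟩ := GFinite.of_retract (.refl _) (gFinite_of_thickening hX _ M hM) hK
  have hC (j : ℤ) (hj : j ≤ i) : FinDim (Gproj A) (K.opcycles j) := by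
    by_cases hjk : j ≤ k
    · exact .of_mem (hk j hjk)
    · obtain ⟨r, rfl⟩ : ∃ r : ℕ, j = k + r := ⟨(j - k).toNat, by lia⟩
      clear hjk
      induction r with
      | zero => exact .of_mem (hk _ (by simp))
      | succ r ih =>
        exact .cosyzygy _ _ (hP _) (ses_opcycles K (k + r) _ (by lia)
          (hK.exactAt i _ (by lia))) (ih (by lia))
  obtain ⟨L, G, ι, π, hS, hL, hG⟩ := exists_approximation (hC (i - 1) (by lia))
  obtain ⟨b, rfl⟩ := hS.exists_extension _ _ (perp_of_gproj hG Z hZ _ (by lia)) b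
  rw [← Category.assoc]
  exact comp_eq_zero_of_thickening (X := X) (Y := FinDim (isProjective A))
    (fun B N hB hN k hk => extVanish_of_finDim (hX _ hB) hN hk)
    (fun N hN => finDim_projective_syzygy hN) n M hM i hL _ hm b

/-- The cokernels in small degrees are Gorenstein projective, and up to degree `i - n` this property
passes from one to the next. -/
lemma gproj_opcycles (hM : thickening (inDb X) (n + 1) M) : Gproj A (K.opcycles (i - n)) := by
  obtain ⟨k, hk⟩ := GFinite.of_retract (.refl _) (gFinite_of_thickening hX _ M hM) hK
  have key (r : ℕ) (hr : k + r ≤ i - n) : Gproj A (K.opcycles (k + r)) := by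
    induction r with
    | zero => exact hk _ (by simp)
    | succ r ih =>
      obtain ⟨j, hj⟩ : ∃ j, j = k + r := ⟨_, rfl⟩
      have hj' : k + (r + 1 : ℕ) = j + 1 := by lia
      rw [hj']
      rw [← hj] at ih
      have := hK.projective (j + 1)
      exact (ses_opcycles K j (j + 1) rfl (hK.exactAt i j (by lia))).gproj₃
        (fun Z hZ α => hK.exists_desc j (fun f =>
          hom_eq_zero_of_thickening_gproj hK i n hX hM hZ _ (by lia) f) α) (ih (by lia))
  by_cases h : i - n ≤ k
  · exact hk _ h
  · convert key (i - n - k).toNat (by lia) using 2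
    lia

end
end

/-! ### Resolution dimension and level -/

section
variable {A : Type u} [Category.{v} A] [Abelian A] [HasDerivedCategory.{w} A]

lemma hsup_eq_of_isGreatest {M : DerivedCategory A} {s : ℤ}
    (hs : IsGreatest {k : ℤ | ¬ IsZero ((homologyFunctor A k).obj M)} s) :
    hsup M = ((s : ℝ) : EReal) :=
  le_antisymm (iSup₂_le fun k hk => by exact_mod_cast hs.2 hk)
    (le_iSup₂ (f := fun (k : ℤ) (_ : ¬ IsZero ((homologyFunctor A k).obj M)) =>
      ((k : ℝ) : EReal)) s hs.1)

lemma hinf_eq_of_isLeast {M : DerivedCategory A} {i : ℤ}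
    (hi : IsLeast {k : ℤ | ¬ IsZero ((homologyFunctor A k).obj M)} i) :
    hinf M = ((i : ℝ) : EReal) :=
  le_antisymm (iInf₂_le (f := fun (k : ℤ) (_ : ¬ IsZero ((homologyFunctor A k).obj M)) =>
      ((k : ℝ) : EReal)) i hi.1)
    (le_iInf₂ fun k hk => by exact_mod_cast hi.2 hk)

lemma hsup_congr {M N : DerivedCategory A} (e : M ≅ N) : hsup M = hsup N := by
  simp only [hsup, ((homologyFunctor A _).mapIso e).isZero_iff]

lemma hinf_congr {M N : DerivedCategory A} (e : M ≅ N) : hinf M = hinf N := by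
  simp only [hinf, ((homologyFunctor A _).mapIso e).isZero_iff]

lemma resolDim_congr (X : ObjectProperty A) {M N : DerivedCategory A} (e : M ≅ N) :
    resolDim X M = resolDim X N := by
  have h (K : CochainComplex A ℤ) : Nonempty (Q.obj K ≅ M) ↔ Nonempty (Q.obj K ≅ N) :=
    ⟨fun ⟨e'⟩ => ⟨e' ≪≫ e⟩, fun ⟨e'⟩ => ⟨e' ≪≫ e.symm⟩⟩
  simp only [resolDim, h, hsup_congr e]

/-- If the cokernel in degree `t` of a projective resolution belongs to `Y`, then the truncation
of the resolution in degree `t` bounds the `Y`-resolution dimension. -/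
lemma IsProjResolution.resolDim_le {Y : ObjectProperty A} [Y.IsClosedUnderIsomorphisms]
    (hY : isProjective A ≤ Y) {K : CochainComplex A ℤ} {s : ℤ} {M : DerivedCategory A}
    (hK : IsProjResolution K s M) (hs : hsup M = ((s : ℝ) : EReal)) (t : ℤ) [hM : M.IsGE t]
    (ht : Y (K.opcycles t)) : resolDim Y M ≤ (((-t : ℤ) : ℝ) : EReal) := by
  obtain ⟨e⟩ := hK.nonempty_iso
  have : K.IsGE t := by
    rw [← isGE_Q_obj_iff]
    exact TStructure.t.isGE_of_iso e.symm t
  have := hK.isStrictlyLE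
  refine iInf₂_le_of_le (-t) ⟨K.truncGE t, ⟨(asIso (Q.map (K.πTruncGE t))).symm ≪≫ e⟩,
    fun k hk => (K.truncGE t).isZero_of_isStrictlyGE t k (by lia), fun k hk => ?_,
    fun k hk _ => ?_⟩ le_rfl
  · rw [hs] at hk
    exact (K.truncGE t).isZero_of_isStrictlyLE s k (by exact_mod_cast hk)
  · rw [neg_neg] at hk
    obtain rfl | hk := hk.eq_or_lt
    · exact Y.prop_of_iso (K.truncGEXIsoOpcycles t).symm ht
    · exact Y.prop_of_iso (K.truncGEXIso t k hk).symm (hY _ (hK.projective k))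

/-- The lower bound for the level, given that truncating a projective resolution as prescribed by
the level yields a term in `Y`. -/
lemma resolDim_add_hinf_add_one_le [EnoughProjectives A] {X Y : ObjectProperty A}
    [Y.IsClosedUnderIsomorphisms] (hY : isProjective A ≤ Y)
    (h : ∀ (K : CochainComplex A ℤ) (s : ℤ) (M : Bounded A), IsProjResolution K s M.obj →
      ∀ (i : ℤ), M.obj.IsGE i → ∀ n : ℕ, thickening (inDb X) (n + 1) M → Y (K.opcycles (i - n)))
    (M : Bounded A) (hM : ¬ IsZero M) :
    resolDim Y M.obj + hinf M.obj + 1 ≤ levelDb X M := by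
  obtain ⟨⟨a, (ha : M.obj.IsGE a)⟩, ⟨b, (hb : M.obj.IsLE b)⟩⟩ := M.property
  have ha' (k : ℤ) (hk : ¬ IsZero ((homologyFunctor A k).obj M.obj)) : a ≤ k := by
    by_contra! hak
    exact hk ((isGE_iff _ _).1 ha k hak)
  have hb' (k : ℤ) (hk : ¬ IsZero ((homologyFunctor A k).obj M.obj)) : k ≤ b := by
    by_contra! hbk
    exact hk ((isLE_iff _ _).1 hb k hbk)
  have hne : ∃ k : ℤ, ¬ IsZero ((homologyFunctor A k).obj M.obj) := by
    by_contra! h0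
    refine hM ?_
    have : M.obj.IsGE (b + 1) := (isGE_iff _ _).2 fun k _ => h0 k
    have hz : IsZero M.obj := TStructure.t.isZero M.obj b (b + 1) (by lia)
    rw [IsZero.iff_id_eq_zero]
    exact Bounded.ι.map_injective (hz.eq_of_src _ _)
  obtain ⟨i, hi, hi'⟩ := Int.exists_least_of_bdd ⟨a, ha'⟩ hne
  obtain ⟨s, hs, hs'⟩ := Int.exists_greatest_of_bdd ⟨b, hb'⟩ hne
  have hiM : M.obj.IsGE i := (isGE_iff _ _).2 fun k hk => by
    by_contra h0
    exact absurd (hi' k h0) (by lia)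
  have hsM : M.obj.IsLE s := (isLE_iff _ _).2 fun k hk => by
    by_contra h0
    exact absurd (hs' k h0) (by lia)
  have his : i ≤ s := hi' s hs
  obtain ⟨K, hK⟩ := exists_projResolution i (s + 1 - i).toNat s (by lia) M.obj
  refine le_iInf₂ fun n hn => ?_
  obtain - | n := n
  · exact absurd hn hM
  have := TStructure.t.isGE_of_ge M.obj (i - n) i
  have hle := hK.resolDim_le hY (hsup_eq_of_isGreatest ⟨hs, hs'⟩) (i - n) (h K s M hK i hiM n hn)
  rw [hinf_eq_of_isLeast ⟨hi, hi'⟩]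
  calc resolDim Y M.obj + ((i : ℝ) : EReal) + 1
      ≤ (((-(i - n) : ℤ) : ℝ) : EReal) + ((i : ℝ) : EReal) + ((1 : ℝ) : EReal) := by
        gcongr
        exact le_rfl
    _ = ((n + 1 : ℕ) : EReal) := by
        rw [← EReal.coe_add, ← EReal.coe_add, ← EReal.coe_natCast]
        congr 1
        push_cast
        ring

instance : (isProjective A).IsClosedUnderIsomorphisms where
  of_iso e (_ : Projective _) := Projective.of_iso e inferInstance

variable [EnoughProjectives A]

lemma pd_add_hinf_add_one_le (M : DerivedCategory A) (hM : ¬ IsZero M) :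
    pd M + hinf M + 1 ≤ levelDbOfComplex (isProjective A) M := by
  refine le_iInf₂ fun N ⟨e⟩ => ?_
  rw [pd, ← resolDim_congr _ e, ← hinf_congr e]
  refine resolDim_add_hinf_add_one_le le_rfl (fun _ _ _ hK i _ n hn =>
    projective_opcycles hK i n hn) N fun hN => hM ?_
  exact (Bounded.ι.map_isZero hN).of_iso e.symm

lemma gpd_add_hinf_add_one_le {X : ObjectProperty A} (hX : X ≤ Gproj A) (M : Bounded A)
    (hM : ¬ IsZero M) : Gpd M.obj + hinf M.obj + 1 ≤ levelDb X M :=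
  resolDim_add_hinf_add_one_le (fun P hP => have : Projective P := hP; gproj_of_projective P)
    (fun _ _ _ hK i _ n hn => gproj_opcycles hK i n hX hn) M hM

end

/-! ### Totally reflexive modules -/

section
variable {R : Type u} [CommRing R]

variable (R) in
/-- The groups `Extⁱ(V, R)` vanish for all `i > 0`. -/
def ExtToRingVanish (V : Type u) [AddCommGroup V] [Module R V] : Prop :=
  ∀ i : ℕ, 0 < i → Subsingleton (Abelian.Ext.{u} (ModuleCat.of R V) (ModuleCat.of R R) i)

variable (R) in
/-- The module `V` is reflexive, and neither `V` nor its dual has higher extensions to the ring. -/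
def IsTotallyReflexive (V : Type u) [AddCommGroup V] [Module R V] : Prop :=
  Module.IsReflexive R V ∧ ExtToRingVanish R V ∧ ExtToRingVanish R (Module.Dual R V)

lemma extToRingVanish_of_projective (V : Type u) [AddCommGroup V] [Module R V]
    [Module.Projective R V] : ExtToRingVanish R V := by
  intro i hi
  obtain ⟨j, rfl⟩ : ∃ j, i = j + 1 := ⟨i - 1, by lia⟩
  exact Abelian.Ext.subsingleton_of_projective _ _ _

lemma ExtToRingVanish.of_equiv {V W : Type u} [AddCommGroup V] [Module R V] [AddCommGroup W]
    [Module R W] (h : ExtToRingVanish R V) (e : V ≃ₗ[R] W) : ExtToRingVanish R W := by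
  intro i hi
  have := h i hi
  refine subsingleton_of_forall_eq 0 fun x => ?_
  have h1 : (Abelian.Ext.mk₀ e.toModuleIso.hom).comp x (zero_add i) = 0 := Subsingleton.elim _ _
  have h2 : (Abelian.Ext.mk₀ e.toModuleIso.inv).comp
      ((Abelian.Ext.mk₀ e.toModuleIso.hom).comp x (zero_add i)) (zero_add i) = x := by
    rw [Abelian.Ext.mk₀_comp_mk₀_assoc, Iso.inv_hom_id, Abelian.Ext.mk₀_id_comp]
  rw [← h2, h1, Abelian.Ext.comp_zero]

section
variable {N F M : Type u} [AddCommGroup N] [Module R N] [AddCommGroup F] [Module R F]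
  [AddCommGroup M] [Module R M] {f : N →ₗ[R] F} {g : F →ₗ[R] M}

lemma shortExact_of_function_exact (hf : Function.Injective f) (hg : Function.Surjective g)
    (hfg : Function.Exact f g) :
    (ShortComplex.mk (ModuleCat.ofHom f) (ModuleCat.ofHom g) (by
      rw [← ModuleCat.ofHom_comp, hfg.linearMap_comp_eq_zero]; rfl)).ShortExact where
  exact := (ShortComplex.ShortExact.moduleCat_exact_iff_function_exact _).2 hfg
  mono_f := (ModuleCat.mono_iff_injective _).2 hf
  epi_g := (ModuleCat.epi_iff_surjective _).2 hg

lemma ExtToRingVanish.of_exact₁ [Module.Projective R F] (hf : Function.Injective f)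
    (hg : Function.Surjective g) (hfg : Function.Exact f g) (hM : ExtToRingVanish R M) :
    ExtToRingVanish R N := by
  intro i hi
  have hS := shortExact_of_function_exact hf hg hfg
  refine subsingleton_of_forall_eq 0 fun x => ?_
  have := hM (1 + i) (by lia)
  have := extToRingVanish_of_projective (R := R) F i hi
  obtain ⟨y, rfl⟩ := Abelian.Ext.contravariant_sequence_exact₁ hS _ x rfl (Subsingleton.elim _ _)
  obtain rfl : y = 0 := Subsingleton.elim _ _
  exact Abelian.Ext.comp_zero _ _ _ _ _

lemma ExtToRingVanish.exists_extension (hM : ExtToRingVanish R M) (hf : Function.Injective f)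
    (hg : Function.Surjective g) (hfg : Function.Exact f g) (α : N →ₗ[R] R) :
    ∃ β : F →ₗ[R] R, β ∘ₗ f = α := by
  have hS := shortExact_of_function_exact hf hg hfg
  have := hM 1 one_pos
  obtain ⟨y, hy⟩ := Abelian.Ext.contravariant_sequence_exact₁ hS (ModuleCat.of R R)
    (Abelian.Ext.mk₀ (ModuleCat.ofHom α)) rfl (Subsingleton.elim _ _)
  obtain ⟨b, rfl⟩ := (Abelian.Ext.mk₀_bijective _ _).2 y
  rw [Abelian.Ext.mk₀_comp_mk₀] at hy
  have h := (Abelian.Ext.mk₀_bijective _ _).1 hy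
  exact ⟨b.hom, congrArg ModuleCat.Hom.hom h⟩

lemma ExtToRingVanish.of_exact₃ [Module.Projective R F] (hf : Function.Injective f)
    (hg : Function.Surjective g) (hfg : Function.Exact f g) (hN : ExtToRingVanish R N)
    (h : ∀ α : N →ₗ[R] R, ∃ β : F →ₗ[R] R, β ∘ₗ f = α) : ExtToRingVanish R M := by
  intro i hi
  have hS := shortExact_of_function_exact hf hg hfg
  refine subsingleton_of_forall_eq 0 fun x => ?_
  have := extToRingVanish_of_projective (R := R) F i hi
  obtain ⟨j, hj⟩ : ∃ j, 1 + j = i := ⟨i - 1, by lia⟩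
  obtain ⟨y, rfl⟩ := Abelian.Ext.contravariant_sequence_exact₃ hS _ x (Subsingleton.elim _ _) hj
  obtain rfl | hj0 := Nat.eq_zero_or_pos j
  · obtain ⟨a, rfl⟩ := (Abelian.Ext.mk₀_bijective _ _).2 y
    obtain ⟨b, hb⟩ := h a.hom
    obtain rfl : ModuleCat.ofHom f ≫ ModuleCat.ofHom b = a := ModuleCat.hom_ext hb
    rw [← Abelian.Ext.mk₀_comp_mk₀]
    exact hS.extClass_comp_assoc _
  · have := hN j hj0
    obtain rfl : y = 0 := Subsingleton.elim _ _
    exact Abelian.Ext.comp_zero _ _ _ _ _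

lemma exists_comp_eq_of_exact (hg : Function.Surjective g) (hfg : Function.Exact f g) {W : Type u}
    [AddCommGroup W] [Module R W] (φ : F →ₗ[R] W) (h : φ ∘ₗ f = 0) :
    ∃ ψ : M →ₗ[R] W, ψ ∘ₗ g = φ := by
  have hker : LinearMap.ker g ≤ LinearMap.ker φ := by
    intro x hx
    obtain ⟨y, rfl⟩ := (hfg x).1 hx
    exact LinearMap.congr_fun h y
  refine ⟨(LinearMap.ker g).liftQ φ hker ∘ₗ (g.quotKerEquivOfSurjective hg).symm, ?_⟩
  ext x
  have : (g.quotKerEquivOfSurjective hg).symm (g x) = (LinearMap.ker g).mkQ x := by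
    rw [LinearEquiv.symm_apply_eq]; rfl
  simp [this]

lemma exact_dualMap (hg : Function.Surjective g) (hfg : Function.Exact f g) :
    Function.Exact g.dualMap f.dualMap := by
  intro φ
  refine ⟨fun h => exists_comp_eq_of_exact hg hfg φ h, ?_⟩
  rintro ⟨ψ, rfl⟩
  ext x
  simp [hfg.apply_apply_eq_zero x]

end

lemma IsTotallyReflexive.dual {V : Type u} [AddCommGroup V] [Module R V]
    (h : IsTotallyReflexive R V) : IsTotallyReflexive R (Module.Dual R V) := by
  obtain ⟨h₁, h₂, h₃⟩ := h
  exact ⟨inferInstance, h₃, h₂.of_equiv (Module.evalEquiv R V)⟩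

section
variable {N F M : Type u} [AddCommGroup N] [Module R N] [AddCommGroup F] [Module R F]
  [AddCommGroup M] [Module R M] {f : N →ₗ[R] F} {g : F →ₗ[R] M} (hM : IsTotallyReflexive R M)
  (hf : Function.Injective f) (hg : Function.Surjective g) (hfg : Function.Exact f g)
include hM hf hg hfg

lemma IsTotallyReflexive.surjective_dualMap : Function.Surjective f.dualMap :=
  fun α => hM.2.1.exists_extension hf hg hfg α

/-- Reflexivity of `N` follows from that of `F` and `M` since the dual sequence is exact; the latter
resolves the dual of `N`, whose first extensions to `R` vanish as `M` is reflexive. -/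
lemma IsTotallyReflexive.syzygy [Module.Finite R F] [Module.Projective R F] :
    IsTotallyReflexive R N := by
  have hM' := hM.1
  have hsurj := hM.surjective_dualMap hf hg hfg
  have hinj : Function.Injective g.dualMap := LinearMap.dualMap_injective_of_surjective hg
  have hex := exact_dualMap hg hfg
  refine ⟨⟨⟨fun x y hxy => ?_, fun x => ?_⟩⟩, hM.2.1.of_exact₁ hf hg hfg,
    hM.2.2.of_exact₃ hinj hsurj hex fun α => ?_⟩
  · apply hf
    apply (Module.bijective_dual_eval R F).injective
    ext φ
    exact LinearMap.congr_fun hxy (φ ∘ₗ f)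
  · obtain ⟨y, hy⟩ := (Module.bijective_dual_eval R F).surjective (x ∘ₗ f.dualMap)
    have hgy : g y = 0 := by
      apply (Module.bijective_dual_eval R M).injective
      rw [map_zero]
      ext φ
      have h1 : φ (g y) = x (f.dualMap (g.dualMap φ)) := LinearMap.congr_fun hy (g.dualMap φ)
      rw [hex.apply_apply_eq_zero, map_zero] at h1
      exact h1
    obtain ⟨z, rfl⟩ := (hfg y).1 hgy
    refine ⟨z, ?_⟩
    ext φ
    obtain ⟨ψ, rfl⟩ := hsurj φ
    exact LinearMap.congr_fun hy ψ
  · obtain ⟨x, rfl⟩ := (Module.bijective_dual_eval R M).surjective α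
    obtain ⟨y, rfl⟩ := hg x
    exact ⟨Module.Dual.eval R F y, rfl⟩

end

/-! ### Finitely generated modules over a noetherian ring -/

section
variable [IsNoetherianRing R]

/- The inclusion of the finitely generated modules into all modules is exact. -/

lemma fgModuleCat_epi_iff {X Y : FGModuleCat.{u} R} (f : X ⟶ Y) :
    Epi f ↔ Function.Surjective f.hom.hom := by
  rw [← ModuleCat.epi_iff_surjective]
  exact ((forget₂ (FGModuleCat.{u} R) (ModuleCat.{u} R)).epi_map_iff_epi f).symm

lemma fgModuleCat_mono_iff {X Y : FGModuleCat.{u} R} (f : X ⟶ Y) :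
    Mono f ↔ Function.Injective f.hom.hom := by
  rw [← ModuleCat.mono_iff_injective]
  exact ((forget₂ (FGModuleCat.{u} R) (ModuleCat.{u} R)).mono_map_iff_mono f).symm

lemma projective_fgModuleCat_of (P : Type u) [AddCommGroup P] [Module R P] [Module.Finite R P]
    [Module.Projective R P] : Projective (FGModuleCat.of R P) where
  factors f e he := by
    obtain ⟨h, hh⟩ := Module.projective_lifting_property e.hom.hom f.hom.hom
      ((fgModuleCat_epi_iff e).1 he)
    exact ⟨FGModuleCat.ofHom h, FGModuleCat.hom_ext hh⟩

lemma exists_epi_from_free (M : FGModuleCat.{u} R) :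
    ∃ (n : ℕ) (p : FGModuleCat.of R (Fin n → R) ⟶ M), Epi p := by
  obtain ⟨n, f, hf⟩ := Module.Finite.exists_fin' R M
  exact ⟨n, FGModuleCat.ofHom f, (fgModuleCat_epi_iff _).2 hf⟩

instance : EnoughProjectives (FGModuleCat.{u} R) where
  presentation M := by
    obtain ⟨n, p, hp⟩ := exists_epi_from_free M
    exact ⟨{ p := _, projective := projective_fgModuleCat_of _, f := p, epi := hp }⟩

/-- Morphisms to `R` extend along `f`, hence so do those to finite free modules and to their direct
summands. -/
lemma gStep_of_exact {N F M : Type u} [AddCommGroup N] [Module R N] [AddCommGroup F] [Module R F]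
    [AddCommGroup M] [Module R M] [Module.Finite R N] [Module.Finite R F] [Module.Finite R M]
    [Module.Projective R F] {f : N →ₗ[R] F} {g : F →ₗ[R] M} (hf : Function.Injective f)
    (hg : Function.Surjective g) (hfg : Function.Exact f g)
    (h : Function.Surjective f.dualMap) :
    GStep (FGModuleCat.of R N) (FGModuleCat.of R M) := by
  have : Mono (FGModuleCat.ofHom f) := (fgModuleCat_mono_iff _).2 hf
  have : Epi (FGModuleCat.ofHom g) := (fgModuleCat_epi_iff _).2 hg
  refine ⟨FGModuleCat.of R F, FGModuleCat.ofHom f, FGModuleCat.ofHom g,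
    projective_fgModuleCat_of F, SES.of_exists_desc ?_ fun t ht => ?_, fun Q hQ a => ?_⟩
  · exact FGModuleCat.hom_ext hfg.linearMap_comp_eq_zero
  · have ht' : t.hom.hom ∘ₗ f = 0 :=
      congrArg (fun φ : FGModuleCat.of R N ⟶ _ => φ.hom.hom) ht
    obtain ⟨ψ, hψ⟩ := exists_comp_eq_of_exact hg hfg t.hom.hom ht'
    exact ⟨FGModuleCat.ofHom ψ, FGModuleCat.hom_ext hψ⟩
  · obtain ⟨n, p, hp⟩ := exists_epi_from_free Q
    let σ : Q ⟶ FGModuleCat.of R (Fin n → R) := Projective.factorThru (𝟙 Q) p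
    have hσ : σ ≫ p = 𝟙 Q := Projective.factorThru_comp _ _
    choose β hβ using fun j : Fin n => h (LinearMap.proj j ∘ₗ (a ≫ σ).hom.hom)
    have hb : FGModuleCat.ofHom f ≫ FGModuleCat.ofHom (LinearMap.pi β) = a ≫ σ := by
      refine FGModuleCat.hom_ext ?_
      ext x j
      exact LinearMap.congr_fun (hβ j) x
    exact ⟨FGModuleCat.ofHom (LinearMap.pi β) ≫ p, by
      rw [← Category.assoc, hb, Category.assoc, hσ, Category.comp_id]⟩

/-- A totally reflexive module has totally reflexive syzygies, and the dual of a syzygy of its dual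
is a cosyzygy of it. -/
lemma tref_le_gproj : tref R ≤ Gproj (FGModuleCat.{u} R) := by
  have key (M : Type u) [AddCommGroup M] [Module R M] [Module.Finite R M] :
      ∃ (n : ℕ) (g : (Fin n → R) →ₗ[R] M), Function.Surjective g ∧
        Function.Exact (LinearMap.ker g).subtype g := by
    obtain ⟨n, g, hg⟩ := Module.Finite.exists_fin' R M
    exact ⟨n, g, hg, LinearMap.exact_subtype_ker_map g⟩
  refine gproj_of_coinduction (fun M hM => ?_) (fun M hM => ?_)
  · have hM' : IsTotallyReflexive R M := hM
    have hMr := hM'.1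
    obtain ⟨n, g, hg, hfg⟩ := key (Module.Dual R M)
    have hN := hM'.dual.syzygy (Submodule.subtype_injective _) hg hfg
    let e := Module.evalEquiv R M
    refine ⟨FGModuleCat.of R (Module.Dual R (LinearMap.ker g)),
      gStep_of_exact (F := Module.Dual R (Fin n → R)) (f := g.dualMap ∘ₗ e.toLinearMap)
        (g := (LinearMap.ker g).subtype.dualMap) ?_ ?_ ?_ ?_, hN.dual⟩
    · exact (LinearMap.dualMap_injective_of_surjective hg).comp e.injective
    · exact hM'.dual.surjective_dualMap (Submodule.subtype_injective _) hg hfg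
    · intro φ
      rw [exact_dualMap hg hfg φ]
      exact ⟨fun ⟨y, hy⟩ => ⟨e.symm y, by simpa using hy⟩, fun ⟨y, hy⟩ => ⟨e y, hy⟩⟩
    · intro α
      obtain ⟨y, hy⟩ := hg α
      refine ⟨Module.Dual.eval R _ y, ?_⟩
      ext x
      have : g y x = α x := by rw [hy]
      exact this
  · have hM' : IsTotallyReflexive R M := hM
    obtain ⟨n, g, hg, hfg⟩ := key M
    exact ⟨FGModuleCat.of R (LinearMap.ker g),
      gStep_of_exact (Submodule.subtype_injective _) hg hfg
        (hM'.surjective_dualMap (Submodule.subtype_injective _) hg hfg),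
      hM'.syzygy (Submodule.subtype_injective _) hg hfg⟩

end
end

end LevelBound

theorem mainTheorem5 :
    (∀ (R : Type u) [Ring R] [HasDerivedCategory.{w} (ModuleCat.{u} R)]
      (M : DerivedCategory (ModuleCat.{u} R)), ¬ CategoryTheory.Limits.IsZero M →
      LevelBound.pd M + LevelBound.hinf M + 1 ≤
        LevelBound.levelDbOfComplex (CategoryTheory.isProjective (ModuleCat.{u} R)) M) ∧
    (∀ (R : Type u) [CommRing R] [HasDerivedCategory.{w} (ModuleCat.{u} R)]
      (M : DerivedCategory.Bounded (ModuleCat.{u} R)), ¬ CategoryTheory.Limits.IsZero M →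
      LevelBound.Gpd M.obj + LevelBound.hinf M.obj + 1 ≤
        LevelBound.levelDb (LevelBound.Gproj (ModuleCat.{u} R)) M) ∧
    (∀ (R : Type u) [CommRing R] [IsNoetherianRing R]
      [HasDerivedCategory.{w} (FGModuleCat.{u} R)]
      (M : DerivedCategory.Bounded (FGModuleCat.{u} R)), ¬ CategoryTheory.Limits.IsZero M →
      LevelBound.Gdim M.obj + LevelBound.hinf M.obj + 1 ≤
        LevelBound.levelDb (LevelBound.tref R) M) :=
  ⟨fun _ _ _ M hM => LevelBound.pd_add_hinf_add_one_le M hM,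
    fun _ _ _ M hM => LevelBound.gpd_add_hinf_add_one_le le_rfl M hM,
    fun _ _ _ _ M hM => LevelBound.gpd_add_hinf_add_one_le LevelBound.tref_le_gproj M hM⟩
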